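/- Let $M$ be a smooth manifold of dimension $n\ge 2$ and $F$ a Finsler metric on $M$ (a nonnegative function on $TM$, $C^\infty$ on $TM\setminus\{0\}$, positively homogeneous of degree one in $y$, with $g_{ij}=\tfrac12 (F^2)_{.i.j}$ positive definite for $y\neq 0$). A subscript "$.k$" denotes $\partial/\partial y^k$, "$|$" the horizontal covariant derivative of the Berwald connection, and the index $0$ contraction with $y$. Let $G^i=\tfrac14 g^{il}\{(F^2)_{x^k y^l}y^k-(F^2)_{x^l}\}$ be the spray coefficients, $D_j{}^i{}_{kl}=\bigl(G^i-\tfrac1{n+1}G^m{}_{.m}\,y^i\bigr)_{.j.k.l}$ the Douglas curvature, and $$R^i{}_k=2\frac{\partial G^i}{\partial x^k}-\frac{\partial^2G^i}{\partial x^m\partial y^k}y^m+2G^m\frac{\partial^2G^i}{\partial y^m\partial y^k}-\frac{\partial G^i}{\partial y^m}\frac{\partial G^m}{\partial y^k}$$ the Riemann curvature. Put $A^i{}_k=R^i{}_k-\tfrac1{n-1}R^m{}_m\delta^i_k$. The Weyl curvature and the weakly-Weyl curvature are $$W^i{}_k=A^i{}_k-\tfrac1{n+1}A^m{}_{k.m}\,y^i,\qquad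 \tilde W_j{}^i{}_{kl}=W_j{}^i{}_{ml.k}\,y^m,\qquad W_j{}^i{}_{kl}=\tfrac13\bigl(W^i{}_{k.l}-W^i{}_{l.k}\bigr)_{.j}.$$ $F$ is a Weyl metric if $W^i{}_k=0$, a Douglas metric if $D_j{}^i{}_{kl}=0$, a weakly-Weyl metric if $\tilde W_j{}^i{}_{kl}=0$, and a generalized weakly-Weyl metric if $$\tilde W_j{}^i{}_{kl|0}+\lambda F\,\tilde W_j{}^i{}_{kl}=\mu_r\tilde W_j{}^r{}_{kl}\,y^i$$ for some smooth scalar function $\lambda$ and some smooth covector field $\mu_r$ on $TM\setminus\{0\}$. Then the Weyl metrics form a proper subclass of the generalized weakly-Weyl metrics in every dimension $n\ge3$. In detail: 1. For $n\ge 2$, every Weyl metric on an $n$-dimensional manifold is a generalized weakly-Weyl metric. 2. Let $n\ge3$ and let $\nu>0$, $a,b,\lambda$ be real constants with $a+br^2>0$ for $0\le r<\nu$, $b\ne0$ and $\lambda\notin\{0,1\}$. Then there are a smooth $f:\mathbb R\to\mathbb R$, functions $h$, and $\varphi:[0,\nu)\times\mathbb R\to\mathbb R$ of the form $$\varphi(r,s)=s\,h(r)-\frac{s}{(a+br^2)^\lambda}\int_{s_0}^s\sigma^{-2}f\!\left(\frac{r^2-\sigma^2}{(a+br^2)^\lambda}\right)d\sigma$$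 (on each half-line $s>0$ and $s<0$, with an arbitrary base point $s_0$ in that half-line, on which $h$ depends), such that $F(x,y)=|y|\,\varphi\bigl(|x|,\langle x,y\rangle/|y|\bigr)$ is a Finsler metric on the ball $\mathbb B^n(\nu)=\{x\in\mathbb R^n:|x|<\nu\}$ which is a Douglas metric, a weakly-Weyl metric and a generalized weakly-Weyl metric, but whose Weyl curvature does not vanish identically, so that it is not a Weyl metric. -/

import Mathlib

open scoped Manifold ContDiff Topology

noncomputable section

namespace FinslerGeom

/-- The coordinate space `ℝⁿ`. -/
abbrev E (n : ℕ) : Type := EuclideanSpace ℝ (Fin n)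

/-- The `k`-th standard basis vector of `ℝⁿ`. -/
def stdVec {n : ℕ} (k : Fin n) : E n := EuclideanSpace.single k 1

/-! ## Calculus in local coordinates

A function on (an open part of) `Tℝⁿ = ℝⁿ × ℝⁿ` is written in curried form `f x y`, where `x` is the
position and `y` the direction. -/

/-- The partial derivative `∂f/∂xᵏ`. -/
def dX {n : ℕ} (k : Fin n) (f : E n → E n → ℝ) : E n → E n → ℝ :=
  fun x y => fderiv ℝ (fun x' => f x' y) x (stdVec k)

/-- The vertical derivative `f_{.k} = ∂f/∂yᵏ`. -/
def dY {n : ℕ} (k : Fin n) (f : E n → E n → ℝ) : E n → E n → ℝ :=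
  fun x y => fderiv ℝ (fun y' => f x y') y (stdVec k)

/-- The Kronecker symbol `δⁱₖ`. -/
def kron {n : ℕ} (i k : Fin n) : ℝ := if i = k then 1 else 0

/-- The fundamental tensor `g_{ij} = ½ (F²)_{.i.j}`. -/
def fundTensor {n : ℕ} (F : E n → E n → ℝ) (x y : E n) : Matrix (Fin n) (Fin n) ℝ :=
  Matrix.of fun i j => (1 / 2 : ℝ) * dY i (dY j (fun x y => F x y ^ 2)) x y

/-- The spray coefficients
`Gⁱ = ¼ gⁱˡ { ∂²F²/∂xᵏ∂yˡ yᵏ - ∂F²/∂xˡ }`. -/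
def sprayCoeff {n : ℕ} (F : E n → E n → ℝ) (i : Fin n) : E n → E n → ℝ :=
  fun x y => (1 / 4 : ℝ) * ∑ l, (fundTensor F x y)⁻¹ i l *
    ((∑ k, dX k (dY l (fun x y => F x y ^ 2)) x y * y k) - dX l (fun x y => F x y ^ 2) x y)

/-- The Riemann curvature `Rⁱₖ` of a spray with coefficients `Gⁱ`. -/
def riem {n : ℕ} (G : Fin n → E n → E n → ℝ) (i k : Fin n) : E n → E n → ℝ :=
  fun x y => 2 * dX k (G i) x y
    - (∑ m, dX m (dY k (G i)) x y * y m)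
    + 2 * (∑ m, G m x y * dY m (dY k (G i)) x y)
    - ∑ m, dY m (G i) x y * dY k (G m) x y

/-- `R = Rᵐₘ / (n - 1)`. -/
def ricScalar {n : ℕ} (G : Fin n → E n → E n → ℝ) : E n → E n → ℝ :=
  fun x y => (∑ m, riem G m m x y) / ((n : ℝ) - 1)

/-- `Aⁱₖ = Rⁱₖ - R δⁱₖ`. -/
def aTensor {n : ℕ} (G : Fin n → E n → E n → ℝ) (i k : Fin n) : E n → E n → ℝ :=
  fun x y => riem G i k x y - ricScalar G x y * kron i k

/-- The (projective) Weyl curvature `Wⁱₖ = Aⁱₖ - 1/(n+1) (Aᵐₖ)_{.m} yⁱ`. -/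
def weyl {n : ℕ} (G : Fin n → E n → E n → ℝ) (i k : Fin n) : E n → E n → ℝ :=
  fun x y => aTensor G i k x y - (1 / ((n : ℝ) + 1)) * (∑ m, dY m (aTensor G m k) x y) * y i

/-- `weyl4 G j i k l` is `W_j{}ⁱ_{kl} = ⅓ (Wⁱ_{k.l} - Wⁱ_{l.k})_{.j}`. -/
def weyl4 {n : ℕ} (G : Fin n → E n → E n → ℝ) (j i k l : Fin n) : E n → E n → ℝ :=
  dY j (fun x y => (1 / 3 : ℝ) * (dY l (weyl G i k) x y - dY k (weyl G i l) x y))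

/-- The weakly-Weyl curvature: `weakWeyl G j i k l` is `W̃_j{}ⁱ_{kl} = W_j{}ⁱ_{ml.k} yᵐ`. -/
def weakWeyl {n : ℕ} (G : Fin n → E n → E n → ℝ) (j i k l : Fin n) : E n → E n → ℝ :=
  fun x y => ∑ m, dY k (weyl4 G j i m l) x y * y m

/-- The Douglas curvature: `douglas G j i k l` is
`D_j{}ⁱ_{kl} = (Gⁱ - 1/(n+1) Gᵐ_{.m} yⁱ)_{.j.k.l}`, written as `B_j{}ⁱ_{kl}` minus the second term. -/
def douglas {n : ℕ} (G : Fin n → E n → E n → ℝ) (j i k l : Fin n) : E n → E n → ℝ :=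
  fun x y => dY j (dY k (dY l (G i))) x y
    - (1 / ((n : ℝ) + 1)) * dY j (dY k (dY l (fun x y => (∑ m, dY m (G m) x y) * y i))) x y

/-- The horizontal derivative `δf/δxᵐ = ∂f/∂xᵐ - Gʳ_{.m} ∂f/∂yʳ` of a function. -/
def dH {n : ℕ} (G : Fin n → E n → E n → ℝ) (m : Fin n) (f : E n → E n → ℝ) : E n → E n → ℝ :=
  fun x y => dX m f x y - ∑ r, dY m (G r) x y * dY r f x y

/-- The horizontal covariant derivative `T_j{}ⁱ_{kl|m}` with respect to the Berwald connection, whose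
coefficients are `Gⁱ_{.j.k}`. The components `T_j{}ⁱ_{kl}` are written `T j i k l`. -/
def covH {n : ℕ} (G : Fin n → E n → E n → ℝ)
    (T : Fin n → Fin n → Fin n → Fin n → E n → E n → ℝ)
    (j i k l m : Fin n) : E n → E n → ℝ :=
  fun x y => dH G m (T j i k l) x y
    + (∑ r, T j r k l x y * dY r (dY m (G i)) x y)
    - (∑ r, T r i k l x y * dY j (dY m (G r)) x y)
    - (∑ r, T j i r l x y * dY k (dY m (G r)) x y)
    - ∑ r, T j i k r x y * dY l (dY m (G r)) x y

/-- The contraction `T_j{}ⁱ_{kl|0} = T_j{}ⁱ_{kl|m} yᵐ`. -/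
def covH0 {n : ℕ} (G : Fin n → E n → E n → ℝ)
    (T : Fin n → Fin n → Fin n → Fin n → E n → E n → ℝ)
    (j i k l : Fin n) : E n → E n → ℝ :=
  fun x y => ∑ m, covH G T j i k l m x y * y m

/-! ## Finsler metrics on manifolds -/

/-- A (smooth, positive definite, positively homogeneous) Finsler metric on an `n`-manifold. -/
structure FinslerMetric (n : ℕ) (M : Type*) [TopologicalSpace M] [ChartedSpace (E n) M]
    [IsManifold (𝓡 n) ∞ M] where
  toFun : (p : M) → TangentSpace (𝓡 n) p → ℝ
  nonneg : ∀ p v, 0 ≤ toFun p v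
  /-- `F` is `C^∞` on the slit tangent bundle. -/
  smooth : ContMDiffOn (𝓡 n).tangent 𝓘(ℝ, ℝ) ∞
    (fun w : TangentBundle (𝓡 n) M => toFun w.1 w.2) {w | w.2 ≠ 0}
  homog : ∀ (c : ℝ), 0 < c → ∀ p (v : TangentSpace (𝓡 n) p), toFun p (c • v) = c * toFun p v
  /-- `g_v(u, u) > 0`, where `g_v(u, w) = ½ ∂²/∂s∂t F²(v + s u + t w)` at `s = t = 0`. -/
  posDef : ∀ p (v u : TangentSpace (𝓡 n) p), v ≠ 0 → u ≠ 0 →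
    0 < (1 / 2 : ℝ) * deriv (fun s : ℝ => deriv (fun t : ℝ => toFun p (v + s • u + t • u) ^ 2) 0) 0

section Manifold

variable {n : ℕ} {M : Type*} [TopologicalSpace M] [ChartedSpace (E n) M]

/-- The tangent vector at `e⁻¹(x)` with components `y` in the chart `e`. -/
def chartVec (e : OpenPartialHomeomorph M (E n)) (x y : E n) : TangentSpace (𝓡 n) (e.symm x) :=
  mfderiv (𝓡 n) (𝓡 n) e.symm x y

/-- A function on the tangent bundle, expressed in the chart `e` as a function of `(x, y)`. -/
def inChart (e : OpenPartialHomeomorph M (E n)) (f : (p : M) → TangentSpace (𝓡 n) p → ℝ) :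
    E n → E n → ℝ :=
  fun x y => f (e.symm x) (chartVec e x y)

/-- The component `μ_r` in the chart `e` of a covector field `μ` along the tangent bundle. -/
def covecComp (e : OpenPartialHomeomorph M (E n))
    (μ : (p : M) → TangentSpace (𝓡 n) p → (TangentSpace (𝓡 n) p →L[ℝ] ℝ)) (r : Fin n) :
    E n → E n → ℝ :=
  fun x y => μ (e.symm x) (chartVec e x y) (chartVec e x (stdVec r))

namespace FinslerMetric

variable [IsManifold (𝓡 n) ∞ M]

/-- The spray coefficients of `F` in the chart `e`. -/
def spray (F : FinslerMetric n M) (e : OpenPartialHomeomorph M (E n)) :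
    Fin n → E n → E n → ℝ :=
  sprayCoeff (inChart e F.toFun)

/-- `F` is a Weyl metric: its Weyl curvature vanishes. -/
def IsWeyl (F : FinslerMetric n M) : Prop :=
  ∀ e ∈ atlas (E n) M, ∀ x ∈ e.target, ∀ y : E n, y ≠ 0 → ∀ i k, weyl (F.spray e) i k x y = 0

/-- `F` is a Douglas metric: its Douglas curvature vanishes. -/
def IsDouglas (F : FinslerMetric n M) : Prop :=
  ∀ e ∈ atlas (E n) M, ∀ x ∈ e.target, ∀ y : E n, y ≠ 0 →
    ∀ j i k l, douglas (F.spray e) j i k l x y = 0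

/-- `F` is a weakly-Weyl metric: its weakly-Weyl curvature vanishes. -/
def IsWeaklyWeyl (F : FinslerMetric n M) : Prop :=
  ∀ e ∈ atlas (E n) M, ∀ x ∈ e.target, ∀ y : E n, y ≠ 0 →
    ∀ j i k l, weakWeyl (F.spray e) j i k l x y = 0

/-- `F` is a generalized weakly-Weyl metric:
`W̃_j{}ⁱ_{kl|0} + lam F W̃_j{}ⁱ_{kl} = μ_r W̃_j{}ʳ_{kl} yⁱ`
for some smooth scalar function `lam` and some smooth covector field `μ` on the slit tangent bundle. -/
def IsGenWeaklyWeyl (F : FinslerMetric n M) : Prop :=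
  ∃ (lam : (p : M) → TangentSpace (𝓡 n) p → ℝ)
    (μ : (p : M) → TangentSpace (𝓡 n) p → (TangentSpace (𝓡 n) p →L[ℝ] ℝ)),
    ContMDiffOn (𝓡 n).tangent 𝓘(ℝ, ℝ) ∞
      (fun w : TangentBundle (𝓡 n) M => lam w.1 w.2) {w | w.2 ≠ 0} ∧
    (∀ e ∈ atlas (E n) M, ∀ r, ContDiffOn ℝ ∞
      (fun z : E n × E n => covecComp e μ r z.1 z.2) (e.target ×ˢ {y : E n | y ≠ 0})) ∧
    ∀ e ∈ atlas (E n) M, ∀ x ∈ e.target, ∀ y : E n, y ≠ 0 → ∀ j i k l,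
      covH0 (F.spray e) (weakWeyl (F.spray e)) j i k l x y
        + inChart e lam x y * inChart e F.toFun x y * weakWeyl (F.spray e) j i k l x y
      = (∑ r, covecComp e μ r x y * weakWeyl (F.spray e) j r k l x y) * y i

end FinslerMetric

end Manifold

/-! ## Spherically symmetric metrics on a ball -/

/-- The open ball `𝔹ⁿ(ν)` of radius `ν` about the origin of `ℝⁿ`, as an open submanifold. -/
def openBall (n : ℕ) (ν : ℝ) : TopologicalSpace.Opens (E n) :=
  ⟨Metric.ball 0 ν, Metric.isOpen_ball⟩

/-- `F = |y| φ(|x|, ⟨x, y⟩ / |y|)` on the ball. Tangent vectors to the ball at `x` are vectors of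
`ℝⁿ`. -/
def IsSphericallySymmetric {n : ℕ} {ν : ℝ} (F : FinslerMetric n (openBall n ν))
    (φ : ℝ → ℝ → ℝ) : Prop :=
  ∀ (x : openBall n ν) (y : E n),
    F.toFun x y = ‖y‖ * φ ‖(x : E n)‖ (inner ℝ (x : E n) y / ‖y‖)

/-- `φ(r, s) = s h(r) - s / (a + b r²)^lam ∫_{s₀}^s σ⁻² f((r² - σ²) / (a + b r²)^lam) dσ`
on `[0, ν) × ℝ`. The integrand is singular at `σ = 0`, so the formula is read on each of the half-lines
`s > 0` and `s < 0`, with the base point `s₀` on the same half-line; moving `s₀` changes only `h`. -/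
def HasProfile (ν a b lam : ℝ) (f : ℝ → ℝ) (φ : ℝ → ℝ → ℝ) : Prop :=
  ∀ s₀ : ℝ, s₀ ≠ 0 → ∃ h : ℝ → ℝ, ∀ r ∈ Set.Ico 0 ν, ∀ s : ℝ, 0 < s₀ * s →
    φ r s = s * h r - s / (a + b * r ^ 2) ^ lam *
      ∫ σ in s₀..s, (σ ^ 2)⁻¹ * f ((r ^ 2 - σ ^ 2) / (a + b * r ^ 2) ^ lam)

end FinslerGeom

end

/-! A vanishing Weyl curvature forces the weakly-Weyl curvature, a combination of its vertical
derivatives, to vanish. The generalized weakly-Weyl equation then holds with `lam = 0` and `μ = 0`,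
which settles the first claim.

For the second claim take `f = 1`. The integral is then elementary, and a suitable `h` turns the
profile into that of a Randers metric $F = u|y| + h\langle x,y\rangle$ with $u =
(a+b|x|^2)^{-\lambda}$ and $h = u/(1+|x|^2)$. The 1-form $h\langle x,dx\rangle$ is closed because
$h$ is radial, so $F$ has the same unparametrized geodesics as the conformally flat Riemannian
metric $u|y|$. Concretely $G^i = Q^i + P y^i$ with $Q^i = q|y|^2x^i$ and $q = \lambda b/(a+b|x|^2)$
(`sprayCoeff_randers`).

Everything now follows from projective invariance. The Douglas curvature does not see $P$ and
vanishes on quadratic sprays (`douglas_projChange`). The Weyl curvature is that of $Q$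
(`weyl_projChange`) and can be computed explicitly (`weyl_radialSpray`): it is quadratic in $y$, so
the weakly-Weyl curvature, which takes three vertical derivatives of it, is zero. It also carries
the factor $2q_1+4q^2 = 4\lambda(\lambda-1)b^2/(a+b|x|^2)^2$, where $dq = q_1\langle x,dx\rangle$.
This is nonzero exactly because $b\ne0$ and $\lambda\notin\{0,1\}$, and with three orthogonal
directions available one Weyl component is visibly nonzero. -/

noncomputable section

namespace FinslerGeom

/-! ### Calculus on the slit tangent bundle of an open set. -/

section

variable {n : ℕ} {U : Set (E n)}

/-- `f` is smooth on the part of the slit tangent bundle of `ℝⁿ` above `U`. -/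
def SlitSmooth (U : Set (E n)) (f : E n → E n → ℝ) : Prop :=
  ContDiffOn ℝ ∞ (fun z : E n × E n => f z.1 z.2) (U ×ˢ {y : E n | y ≠ 0})

/-- `f x y` is positively homogeneous of degree `d` in `y ≠ 0`, for `x ∈ U`. -/
def SlitHomog (U : Set (E n)) (d : ℤ) (f : E n → E n → ℝ) : Prop :=
  ∀ x ∈ U, ∀ y : E n, y ≠ 0 → ∀ c : ℝ, 0 < c → f x (c • y) = c ^ d * f x y

/-- `f` and `g` agree on the part of the slit tangent bundle of `ℝⁿ` above `U`. -/
def SlitEq (U : Set (E n)) (f g : E n → E n → ℝ) : Prop :=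
  ∀ x ∈ U, ∀ y : E n, y ≠ 0 → f x y = g x y

theorem isOpen_slit (hU : IsOpen U) : IsOpen (U ×ˢ {y : E n | y ≠ 0}) :=
  hU.prod isOpen_ne

theorem stdVec_apply (k i : Fin n) : (stdVec k : E n) i = kron i k := by
  simp [stdVec, kron]

theorem kron_self (i : Fin n) : kron i i = 1 := if_pos rfl

theorem sum_kron_mul (k : Fin n) (g : Fin n → ℝ) : ∑ m, kron m k * g m = g k := by
  simp [kron]

theorem sum_mul_kron (k : Fin n) (g : Fin n → ℝ) : ∑ m, g m * kron m k = g k := by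
  simp [kron]

theorem sum_mul_kron' (k : Fin n) (g : Fin n → ℝ) : ∑ m, g m * kron k m = g k := by
  simp [kron]

theorem sum_smul_stdVec (y : E n) : ∑ m, y m • stdVec m = y := by
  ext i
  simp [stdVec, Pi.single_apply]

theorem fderiv_apply_eq_sum (f : E n → ℝ) (x y : E n) :
    fderiv ℝ f x y = ∑ m, fderiv ℝ f x (stdVec m) * y m := by
  conv_lhs => rw [← sum_smul_stdVec y, map_sum]
  simp [mul_comm]

theorem inner_eq_sum (x y : E n) : inner ℝ x y = ∑ m, x m * y m := by
  simp [PiLp.inner_apply, mul_comm]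

theorem norm_sq_eq_sum (y : E n) : ‖y‖ ^ 2 = ∑ m, y m * y m := by
  rw [← real_inner_self_eq_norm_sq, inner_eq_sum]

namespace SlitEq

/-- The slit fibre is open, so agreement off the zero section passes to vertical derivatives even
when `U` is not open; only `dX_eq` needs `U` open. -/
theorem dY_eq {f g : E n → E n → ℝ} (h : SlitEq U f g) (k : Fin n) :
    SlitEq U (dY k f) (dY k g) := by
  intro x hx y hy
  have : f x =ᶠ[𝓝 y] g x := by
    filter_upwards [isOpen_ne.mem_nhds hy] with y' hy' using h x hx y' hy'
  simp only [dY]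
  exact congrArg (fun L : E n →L[ℝ] ℝ => L (stdVec k)) this.fderiv_eq

theorem dX_eq (hU : IsOpen U) {f g : E n → E n → ℝ} (h : SlitEq U f g) (k : Fin n) :
    SlitEq U (dX k f) (dX k g) := by
  intro x hx y hy
  have : (fun x' => f x' y) =ᶠ[𝓝 x] fun x' => g x' y := by
    filter_upwards [hU.mem_nhds hx] with x' hx' using h x' hx' y hy
  simp only [dX]
  exact congrArg (fun L : E n →L[ℝ] ℝ => L (stdVec k)) this.fderiv_eq

theorem trans {f g k : E n → E n → ℝ} (h : SlitEq U f g) (h' : SlitEq U g k) : SlitEq U f k :=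
  fun x hx y hy => (h x hx y hy).trans (h' x hx y hy)

end SlitEq

@[simp] theorem dY_zero (k : Fin n) (x y : E n) : dY k (fun _ _ => (0 : ℝ)) x y = 0 := by
  simp [dY]

@[simp] theorem dX_zero (k : Fin n) (x y : E n) : dX k (fun _ _ => (0 : ℝ)) x y = 0 := by
  simp [dX]

/-- Functions of the position only have no vertical derivative. -/
@[simp] theorem dY_base (g : E n → ℝ) (k : Fin n) (x y : E n) :
    dY k (fun x _ => g x) x y = 0 := by
  simp [dY]

@[simp] theorem dY_coord (i k : Fin n) (x y : E n) : dY k (fun _ y => y i) x y = kron i k := by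
  have : HasFDerivAt (fun y : E n => y i) (EuclideanSpace.proj i : E n →L[ℝ] ℝ) y :=
    (EuclideanSpace.proj i : E n →L[ℝ] ℝ).hasFDerivAt
  simp only [dY, this.fderiv]
  exact stdVec_apply k i

@[simp] theorem dX_coord (i k : Fin n) (x y : E n) : dX k (fun x _ => x i) x y = kron i k := by
  have : HasFDerivAt (fun x : E n => x i) (EuclideanSpace.proj i : E n →L[ℝ] ℝ) x :=
    (EuclideanSpace.proj i : E n →L[ℝ] ℝ).hasFDerivAt
  simp only [dX, this.fderiv]
  exact stdVec_apply k i

namespace SlitSmooth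

variable {f g : E n → E n → ℝ}

theorem congr (hf : SlitSmooth U f) (h : SlitEq U g f) : SlitSmooth U g :=
  ContDiffOn.congr hf fun z hz => h z.1 hz.1 z.2 hz.2

theorem add (hf : SlitSmooth U f) (hg : SlitSmooth U g) :
    SlitSmooth U fun x y => f x y + g x y := ContDiffOn.add hf hg

theorem sub (hf : SlitSmooth U f) (hg : SlitSmooth U g) :
    SlitSmooth U fun x y => f x y - g x y := ContDiffOn.sub hf hg

theorem mul (hf : SlitSmooth U f) (hg : SlitSmooth U g) :
    SlitSmooth U fun x y => f x y * g x y := ContDiffOn.mul hf hg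

theorem inv (hf : SlitSmooth U f) (h : ∀ x ∈ U, ∀ y : E n, y ≠ 0 → f x y ≠ 0) :
    SlitSmooth U fun x y => (f x y)⁻¹ := ContDiffOn.inv hf fun z hz => h z.1 hz.1 z.2 hz.2

theorem pow (hf : SlitSmooth U f) (m : ℕ) :
    SlitSmooth U fun x y => f x y ^ m := ContDiffOn.pow hf m

theorem sum {ι : Type*} {s : Finset ι} {f : ι → E n → E n → ℝ} (hf : ∀ i, SlitSmooth U (f i)) :
    SlitSmooth U fun x y => ∑ i ∈ s, f i x y := ContDiffOn.sum fun i _ => hf i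

theorem const (c : ℝ) : SlitSmooth U fun _ _ => c := contDiffOn_const

theorem fiber_coord (i : Fin n) : SlitSmooth U fun _ y => y i :=
  ((EuclideanSpace.proj i : E n →L[ℝ] ℝ).contDiff.comp contDiff_snd).contDiffOn

theorem base {g : E n → ℝ} (hg : ContDiffOn ℝ ∞ g U) : SlitSmooth U fun x _ => g x :=
  hg.comp contDiffOn_fst fun _ hz => hz.1

theorem base_coord (i : Fin n) : SlitSmooth U fun x _ => x i :=
  base (EuclideanSpace.proj i : E n →L[ℝ] ℝ).contDiff.contDiffOn

theorem inner : SlitSmooth U fun x y => inner ℝ x y :=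
  (contDiff_fst.inner ℝ contDiff_snd).contDiffOn

theorem norm : SlitSmooth U fun _ y => ‖y‖ :=
  ContDiffOn.norm ℝ contDiffOn_snd fun _ hz => hz.2

theorem differentiableAt (hU : IsOpen U) (hf : SlitSmooth U f) {x y : E n} (hx : x ∈ U)
    (hy : y ≠ 0) : DifferentiableAt ℝ (fun z : E n × E n => f z.1 z.2) (x, y) :=
  (ContDiffOn.contDiffAt hf ((isOpen_slit hU).mem_nhds
    (show (x, y) ∈ U ×ˢ {y : E n | y ≠ 0} from ⟨hx, hy⟩))).differentiableAt (by simp)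

theorem differentiableAt_fiber (hU : IsOpen U) (hf : SlitSmooth U f) {x y : E n} (hx : x ∈ U)
    (hy : y ≠ 0) : DifferentiableAt ℝ (fun y => f x y) y :=
  (hf.differentiableAt hU hx hy).comp (f := fun y => (x, y)) y (by fun_prop)

theorem differentiableAt_base (hU : IsOpen U) (hf : SlitSmooth U f) {x y : E n} (hx : x ∈ U)
    (hy : y ≠ 0) : DifferentiableAt ℝ (fun x => f x y) x :=
  (hf.differentiableAt hU hx hy).comp (f := fun x => (x, y)) x (by fun_prop)

/-- Rewriting a partial derivative as the joint derivative in a fixed direction is what shows that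
it is again jointly smooth in position and direction. -/
theorem dY_eq_fderiv (hU : IsOpen U) (hf : SlitSmooth U f) (k : Fin n) :
    SlitEq U (dY k f)
      fun x y => fderiv ℝ (fun z : E n × E n => f z.1 z.2) (x, y) (0, stdVec k) := by
  intro x hx y hy
  have h := (hf.differentiableAt hU hx hy).hasFDerivAt.comp (f := fun y => (x, y)) y
    ((hasFDerivAt_const x y).prodMk (hasFDerivAt_id y))
  have h' : HasFDerivAt (fun y => f x y) _ y := h
  simp only [dY, h'.fderiv]
  simp

theorem dX_eq_fderiv (hU : IsOpen U) (hf : SlitSmooth U f) (k : Fin n) :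
    SlitEq U (dX k f)
      fun x y => fderiv ℝ (fun z : E n × E n => f z.1 z.2) (x, y) (stdVec k, 0) := by
  intro x hx y hy
  have h := (hf.differentiableAt hU hx hy).hasFDerivAt.comp (f := fun x => (x, y)) x
    ((hasFDerivAt_id x).prodMk (hasFDerivAt_const y x))
  have h' : HasFDerivAt (fun x => f x y) _ x := h
  simp only [dX, h'.fderiv]
  simp

theorem dY (hU : IsOpen U) (hf : SlitSmooth U f) (k : Fin n) : SlitSmooth U (dY k f) := by
  refine SlitSmooth.congr ?_ (hf.dY_eq_fderiv hU k)
  exact (ContDiffOn.fderiv_of_isOpen hf (isOpen_slit hU) (by simp)).clm_apply contDiffOn_const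

theorem dX (hU : IsOpen U) (hf : SlitSmooth U f) (k : Fin n) : SlitSmooth U (dX k f) := by
  refine SlitSmooth.congr ?_ (hf.dX_eq_fderiv hU k)
  exact (ContDiffOn.fderiv_of_isOpen hf (isOpen_slit hU) (by simp)).clm_apply contDiffOn_const

end SlitSmooth

/-! ### Differentiation rules for `dX` and `dY`. -/

section Rules

variable {f g : E n → E n → ℝ} {x y : E n}

theorem dY_add (hU : IsOpen U) (hf : SlitSmooth U f) (hg : SlitSmooth U g) (hx : x ∈ U)
    (hy : y ≠ 0) (k : Fin n) :
    dY k (fun x y => f x y + g x y) x y = dY k f x y + dY k g x y := by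
  simp only [dY]
  rw [fderiv_fun_add (hf.differentiableAt_fiber hU hx hy) (hg.differentiableAt_fiber hU hx hy)]
  rfl

theorem dY_sub (hU : IsOpen U) (hf : SlitSmooth U f) (hg : SlitSmooth U g) (hx : x ∈ U)
    (hy : y ≠ 0) (k : Fin n) :
    dY k (fun x y => f x y - g x y) x y = dY k f x y - dY k g x y := by
  simp only [dY]
  rw [fderiv_fun_sub (hf.differentiableAt_fiber hU hx hy) (hg.differentiableAt_fiber hU hx hy)]
  rfl

theorem dY_mul (hU : IsOpen U) (hf : SlitSmooth U f) (hg : SlitSmooth U g) (hx : x ∈ U)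
    (hy : y ≠ 0) (k : Fin n) :
    dY k (fun x y => f x y * g x y) x y = f x y * dY k g x y + dY k f x y * g x y := by
  simp only [dY]
  rw [fderiv_fun_mul (hf.differentiableAt_fiber hU hx hy) (hg.differentiableAt_fiber hU hx hy)]
  simp [mul_comm]

theorem dY_base_mul (hU : IsOpen U) (b : E n → ℝ) (hg : SlitSmooth U g) (hx : x ∈ U)
    (hy : y ≠ 0) (k : Fin n) :
    dY k (fun x y => b x * g x y) x y = b x * dY k g x y := by
  simp only [dY]
  rw [fderiv_const_mul (hg.differentiableAt_fiber hU hx hy)]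
  simp

theorem dY_const_mul (hU : IsOpen U) (c : ℝ) (hg : SlitSmooth U g) (hx : x ∈ U)
    (hy : y ≠ 0) (k : Fin n) :
    dY k (fun x y => c * g x y) x y = c * dY k g x y :=
  dY_base_mul hU (fun _ => c) hg hx hy k

theorem dY_sum (hU : IsOpen U) {ι : Type*} {s : Finset ι} {f : ι → E n → E n → ℝ}
    (hf : ∀ i, SlitSmooth U (f i)) (hx : x ∈ U) (hy : y ≠ 0) (k : Fin n) :
    dY k (fun x y => ∑ i ∈ s, f i x y) x y = ∑ i ∈ s, dY k (f i) x y := by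
  simp only [dY]
  rw [fderiv_fun_sum fun i _ => (hf i).differentiableAt_fiber hU hx hy]
  simp

theorem dX_add (hU : IsOpen U) (hf : SlitSmooth U f) (hg : SlitSmooth U g) (hx : x ∈ U)
    (hy : y ≠ 0) (k : Fin n) :
    dX k (fun x y => f x y + g x y) x y = dX k f x y + dX k g x y := by
  simp only [dX]
  rw [fderiv_fun_add (hf.differentiableAt_base hU hx hy) (hg.differentiableAt_base hU hx hy)]
  rfl

theorem dX_mul (hU : IsOpen U) (hf : SlitSmooth U f) (hg : SlitSmooth U g) (hx : x ∈ U)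
    (hy : y ≠ 0) (k : Fin n) :
    dX k (fun x y => f x y * g x y) x y = f x y * dX k g x y + dX k f x y * g x y := by
  simp only [dX]
  rw [fderiv_fun_mul (hf.differentiableAt_base hU hx hy) (hg.differentiableAt_base hU hx hy)]
  simp [mul_comm]

theorem dX_mul_fiber (hU : IsOpen U) (hf : SlitSmooth U f) (b : E n → ℝ) (hx : x ∈ U)
    (hy : y ≠ 0) (k : Fin n) :
    dX k (fun x y => f x y * b y) x y = dX k f x y * b y := by
  simp only [dX]
  rw [fderiv_mul_const (hf.differentiableAt_base hU hx hy)]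
  simp [mul_comm]

theorem dX_sum (hU : IsOpen U) {ι : Type*} {s : Finset ι} {f : ι → E n → E n → ℝ}
    (hf : ∀ i, SlitSmooth U (f i)) (hx : x ∈ U) (hy : y ≠ 0) (k : Fin n) :
    dX k (fun x y => ∑ i ∈ s, f i x y) x y = ∑ i ∈ s, dX k (f i) x y := by
  simp only [dX]
  rw [fderiv_fun_sum fun i _ => (hf i).differentiableAt_base hU hx hy]
  simp

@[simp] theorem dY_inner (k : Fin n) (x y : E n) :
    dY k (fun x y => inner ℝ x y) x y = x k := by
  have : HasFDerivAt (fun y : E n => inner ℝ x y) (innerSL ℝ x) y := (innerSL ℝ x).hasFDerivAt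
  simp only [dY, this.fderiv]
  simp [stdVec, EuclideanSpace.inner_single_right]

@[simp] theorem dX_inner (k : Fin n) (x y : E n) :
    dX k (fun x y => inner ℝ x y) x y = y k := by
  have h : (fun x : E n => inner ℝ x y) = fun x => inner ℝ y x :=
    funext fun x => real_inner_comm _ _
  have : HasFDerivAt (fun x : E n => inner ℝ y x) (innerSL ℝ y) x := (innerSL ℝ y).hasFDerivAt
  simp only [dX, h, this.fderiv]
  simp [stdVec, EuclideanSpace.inner_single_right]

theorem fderiv_norm_sq_stdVec (k : Fin n) (y : E n) :
    fderiv ℝ (fun y : E n => ‖y‖ ^ 2) y (stdVec k) = 2 * y k := by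
  rw [fderiv_norm_sq_apply]
  simp [stdVec, EuclideanSpace.inner_single_right]

@[simp] theorem dY_norm_sq (k : Fin n) (x y : E n) :
    dY k (fun _ y => ‖y‖ ^ 2) x y = 2 * y k := fderiv_norm_sq_stdVec k y

/-- Obtained by differentiating $|y|\cdot|y| = |y|^2$; the formula for the inverse norm comes
likewise from $|y|\cdot|y|^{-1} = 1$. -/
theorem dY_norm (k : Fin n) (x : E n) {y : E n} (hy : y ≠ 0) :
    dY k (fun _ y => ‖y‖) x y = y k * ‖y‖⁻¹ := by
  have h1 := dY_norm_sq k x y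
  have h2 := dY_mul isOpen_univ (SlitSmooth.norm (n := n)) SlitSmooth.norm (Set.mem_univ x) hy k
  simp only [sq] at h1
  rw [h1] at h2
  have : ‖y‖ ≠ 0 := norm_ne_zero_iff.2 hy
  field_simp
  linarith

theorem dY_norm_inv (k : Fin n) (x : E n) {y : E n} (hy : y ≠ 0) :
    dY k (fun _ y => ‖y‖⁻¹) x y = -(y k * ‖y‖⁻¹ ^ 3) := by
  have hs : SlitSmooth (Set.univ : Set (E n)) fun _ y => ‖y‖⁻¹ :=
    SlitSmooth.norm.inv fun _ _ _ h => norm_ne_zero_iff.2 h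
  have h2 := dY_mul isOpen_univ (SlitSmooth.norm (n := n)) hs (Set.mem_univ x) hy k
  have h3 : SlitEq (Set.univ : Set (E n)) (fun _ y => ‖y‖ * ‖y‖⁻¹) fun _ _ => 1 :=
    fun _ _ _ h => mul_inv_cancel₀ (norm_ne_zero_iff.2 h)
  rw [h3.dY_eq k x trivial y hy, dY_base (fun _ => (1 : ℝ)), dY_norm k x hy] at h2
  have : ‖y‖ ≠ 0 := norm_ne_zero_iff.2 hy
  field_simp at h2 ⊢
  linarith

end Rules

/-! ### Positive homogeneity and Euler's identity. -/

namespace SlitHomog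

variable {f g : E n → E n → ℝ} {d e : ℤ}

/-- Differentiating $f(x,cy) = c^d f(x,y)$ in $y$ produces a factor $c$ on the left, which lowers
the degree by one. -/
theorem dY (hU : IsOpen U) (hs : SlitSmooth U f) (hf : SlitHomog U d f) (k : Fin n) :
    SlitHomog U (d - 1) (dY k f) := by
  intro x hx y hy c hc
  have hcy : c • y ≠ 0 := smul_ne_zero hc.ne' hy
  have h1 : HasFDerivAt (fun y => f x (c • y)) ((fderiv ℝ (f x) (c • y)).comp
      (c • ContinuousLinearMap.id ℝ (E n))) y :=
    (hs.differentiableAt_fiber hU hx hcy).hasFDerivAt.comp y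
      ((hasFDerivAt_id y).const_smul c)
  have h2 : HasFDerivAt (fun y => c ^ d * f x y) (c ^ d • fderiv ℝ (f x) y) y :=
    (hs.differentiableAt_fiber hU hx hy).hasFDerivAt.const_mul _
  have h3 : (fun y => f x (c • y)) =ᶠ[𝓝 y] fun y => c ^ d * f x y := by
    filter_upwards [isOpen_ne.mem_nhds hy] with y' hy' using hf x hx y' hy' c hc
  have h4 := congrArg (fun L => L (stdVec k)) (h1.unique (h2.congr_of_eventuallyEq h3))
  simp only [ContinuousLinearMap.comp_apply, smul_eq_mul, map_smul,
    smul_apply, ContinuousLinearMap.id_apply] at h4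
  simp only [FinslerGeom.dY]
  rw [zpow_sub_one₀ hc.ne']
  field_simp
  linarith

theorem dX (hU : IsOpen U) (hs : SlitSmooth U f) (hf : SlitHomog U d f) (k : Fin n) :
    SlitHomog U d (dX k f) := by
  intro x hx y hy c hc
  have hcy : c • y ≠ 0 := smul_ne_zero hc.ne' hy
  have h3 : (fun x => f x (c • y)) =ᶠ[𝓝 x] fun x => c ^ d * f x y := by
    filter_upwards [hU.mem_nhds hx] with x' hx' using hf x' hx' y hy c hc
  simp only [FinslerGeom.dX]
  rw [h3.fderiv_eq, fderiv_const_mul (hs.differentiableAt_base hU hx hy)]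
  rfl

/-- Euler's identity: differentiate $c\mapsto f(x,cy)$ at $c=1$ in two ways. -/
theorem euler (hU : IsOpen U) (hs : SlitSmooth U f) (hf : SlitHomog U d f) {x y : E n}
    (hx : x ∈ U) (hy : y ≠ 0) : ∑ m, FinslerGeom.dY m f x y * y m = d * f x y := by
  have h0 : HasDerivAt (fun c : ℝ => c • y) y 1 := by
    simpa using (hasDerivAt_id (1 : ℝ)).smul_const y
  have hd : HasFDerivAt (f x) (fderiv ℝ (f x) y) ((1 : ℝ) • y) := by
    rw [one_smul]
    exact (hs.differentiableAt_fiber hU hx hy).hasFDerivAt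
  have h1 : HasDerivAt (fun c : ℝ => f x (c • y)) (fderiv ℝ (f x) y y) 1 :=
    hd.comp_hasDerivAt (1 : ℝ) h0
  have h2 : HasDerivAt (fun c : ℝ => c ^ d * f x y) (d * f x y) 1 := by
    simpa using (hasDerivAt_zpow d (1 : ℝ) (Or.inl one_ne_zero)).mul_const (f x y)
  have h3 : (fun c : ℝ => f x (c • y)) =ᶠ[𝓝 1] fun c => c ^ d * f x y := by
    filter_upwards [lt_mem_nhds (zero_lt_one' ℝ)] with c hc using hf x hx y hy c hc
  rw [← h1.unique (h2.congr_of_eventuallyEq h3), fderiv_apply_eq_sum]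
  rfl

theorem mul (hf : SlitHomog U d f) (hg : SlitHomog U e g) :
    SlitHomog U (d + e) fun x y => f x y * g x y := by
  intro x hx y hy c hc
  simp only [hf x hx y hy c hc, hg x hx y hy c hc, zpow_add₀ hc.ne']
  ring

theorem add (hf : SlitHomog U d f) (hg : SlitHomog U d g) :
    SlitHomog U d fun x y => f x y + g x y := by
  intro x hx y hy c hc
  simp only [hf x hx y hy c hc, hg x hx y hy c hc]
  ring

theorem sub (hf : SlitHomog U d f) (hg : SlitHomog U d g) :
    SlitHomog U d fun x y => f x y - g x y := by
  intro x hx y hy c hc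
  simp only [hf x hx y hy c hc, hg x hx y hy c hc]
  ring

theorem sum {ι : Type*} {s : Finset ι} {f : ι → E n → E n → ℝ}
    (hf : ∀ i, SlitHomog U d (f i)) : SlitHomog U d fun x y => ∑ i ∈ s, f i x y := by
  intro x hx y hy c hc
  simp only [hf _ x hx y hy c hc, Finset.mul_sum]

theorem coord (i : Fin n) : SlitHomog U 1 fun _ y => y i := by
  intro x hx y hy c hc
  simp

theorem base (b : E n → ℝ) : SlitHomog U 0 fun x _ => b x := by
  intro x hx y hy c hc
  simp

end SlitHomog

end

section

variable {n : ℕ} {U : Set (E n)}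

theorem SlitHomog.cast {d e : ℤ} {f : E n → E n → ℝ} (h : SlitHomog U d f) (hde : d = e) :
    SlitHomog U e f := hde ▸ h

/-! ### Smoothness of the curvature tensors of a smooth spray. -/

section Smoothness

variable {G : Fin n → E n → E n → ℝ}

theorem SlitSmooth.riem (hU : IsOpen U) (hG : ∀ i, SlitSmooth U (G i)) (i k : Fin n) :
    SlitSmooth U (riem G i k) :=
  ((((SlitSmooth.const 2).mul ((hG i).dX hU k)).sub
    (SlitSmooth.sum fun m => (((hG i).dY hU k).dX hU m).mul (SlitSmooth.fiber_coord m))).add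
    ((SlitSmooth.const 2).mul
      (SlitSmooth.sum fun m => (hG m).mul (((hG i).dY hU k).dY hU m)))).sub
    (SlitSmooth.sum fun m => ((hG i).dY hU m).mul ((hG m).dY hU k))

theorem SlitSmooth.ricScalar (hU : IsOpen U) (hG : ∀ i, SlitSmooth U (G i)) :
    SlitSmooth U (ricScalar G) :=
  (SlitSmooth.mul (SlitSmooth.sum fun m => SlitSmooth.riem hU hG m m)
    (SlitSmooth.const ((n : ℝ) - 1)⁻¹)).congr fun _ _ _ _ => div_eq_mul_inv _ _

theorem SlitSmooth.aTensor (hU : IsOpen U) (hG : ∀ i, SlitSmooth U (G i)) (i k : Fin n) :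
    SlitSmooth U (aTensor G i k) :=
  (SlitSmooth.riem hU hG i k).sub ((SlitSmooth.ricScalar hU hG).mul (SlitSmooth.const _))

end Smoothness

/-! ### Projective change of a spray -/

/-- The covector `τ_k` with `Rⁱₖ(Q + P y) = Rⁱₖ(Q) + τ_k yⁱ - τ_m yᵐ δⁱₖ`. -/
def projTau (Q : Fin n → E n → E n → ℝ) (P : E n → E n → ℝ) (k : Fin n) : E n → E n → ℝ :=
  fun x y => 2 * dX k P x y - (∑ m, dX m (dY k P) x y * y m)
    + 2 * (∑ m, Q m x y * dY m (dY k P) x y) - (∑ m, dY m P x y * dY k (Q m) x y)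
    - P x y * dY k P x y

/-- The spray coefficients `Qⁱ + P yⁱ`. -/
def projChange (Q : Fin n → E n → E n → ℝ) (P : E n → E n → ℝ) (i : Fin n) : E n → E n → ℝ :=
  fun x y => Q i x y + P x y * y i

variable {Q : Fin n → E n → E n → ℝ} {P : E n → E n → ℝ} {x y : E n}

theorem SlitSmooth.projTau (hU : IsOpen U) (hQ : ∀ i, SlitSmooth U (Q i)) (hP : SlitSmooth U P)
    (k : Fin n) : SlitSmooth U (projTau Q P k) :=
  (((((SlitSmooth.const 2).mul (hP.dX hU k)).sub
    (SlitSmooth.sum fun m => ((hP.dY hU k).dX hU m).mul (SlitSmooth.fiber_coord m))).add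
    ((SlitSmooth.const 2).mul
      (SlitSmooth.sum fun m => (hQ m).mul ((hP.dY hU k).dY hU m)))).sub
    (SlitSmooth.sum fun m => (hP.dY hU m).mul ((hQ m).dY hU k))).sub (hP.mul (hP.dY hU k))

theorem SlitHomog.projTau (hU : IsOpen U) (hQ : ∀ i, SlitSmooth U (Q i)) (hP : SlitSmooth U P)
    (hQ2 : ∀ i, SlitHomog U 2 (Q i)) (hP1 : SlitHomog U 1 P) (k : Fin n) :
    SlitHomog U 1 (projTau Q P k) := by
  have two : SlitHomog U 0 fun (_ : E n) (_ : E n) => (2 : ℝ) := SlitHomog.base fun _ => 2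
  have hPk : SlitHomog U 0 (FinslerGeom.dY k P) := hP1.dY hU hP k
  refine ((((((two.mul (hP1.dX hU hP k)).cast (by norm_num)).sub
    (SlitHomog.sum fun m => ((hPk.dX hU (hP.dY hU k) m).mul (SlitHomog.coord m)).cast
      (by norm_num))).add ((two.mul (SlitHomog.sum fun m => ((hQ2 m).mul
        (hPk.dY hU (hP.dY hU k) m)))).cast (by norm_num))).sub
    (SlitHomog.sum fun m => ((hP1.dY hU hP m).mul ((hQ2 m).dY hU (hQ m) k)).cast
      (by norm_num))).sub ((hP1.mul hPk).cast (by norm_num)))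

theorem SlitSmooth.projChange (hQ : ∀ i, SlitSmooth U (Q i)) (hP : SlitSmooth U P) (i : Fin n) :
    SlitSmooth U (projChange Q P i) := (hQ i).add (hP.mul (SlitSmooth.fiber_coord i))

theorem dY_projChange (hU : IsOpen U) (hQ : ∀ i, SlitSmooth U (Q i)) (hP : SlitSmooth U P)
    (i k : Fin n) : SlitEq U (dY k (projChange Q P i))
      fun x y => dY k (Q i) x y + (P x y * kron i k + dY k P x y * y i) := by
  intro x hx y hy
  unfold projChange
  rw [dY_add hU (hQ i) (hP.mul (SlitSmooth.fiber_coord i)) hx hy,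
    dY_mul hU hP (SlitSmooth.fiber_coord i) hx hy, dY_coord]

theorem dY_dY_projChange (hU : IsOpen U) (hQ : ∀ i, SlitSmooth U (Q i)) (hP : SlitSmooth U P)
    (i k m : Fin n) : SlitEq U (dY m (dY k (projChange Q P i)))
      fun x y => dY m (dY k (Q i)) x y + (dY m P x y * kron i k
        + (dY k P x y * kron i m + dY m (dY k P) x y * y i)) := by
  intro x hx y hy
  have hc : SlitSmooth U fun (_ : E n) (_ : E n) => kron i k := SlitSmooth.const _
  rw [(dY_projChange hU hQ hP i k).dY_eq m x hx y hy,
    dY_add hU ((hQ i).dY hU k) ((hP.mul hc).add ((hP.dY hU k).mul (SlitSmooth.fiber_coord i)))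
      hx hy,
    dY_add hU (hP.mul hc) ((hP.dY hU k).mul (SlitSmooth.fiber_coord i)) hx hy,
    dY_mul hU hP hc hx hy, dY_mul hU (hP.dY hU k) (SlitSmooth.fiber_coord i) hx hy, dY_coord,
    dY_base (fun _ => kron i k)]
  ring

theorem dX_projChange (hU : IsOpen U) (hQ : ∀ i, SlitSmooth U (Q i)) (hP : SlitSmooth U P)
    (i k : Fin n) : SlitEq U (dX k (projChange Q P i))
      fun x y => dX k (Q i) x y + dX k P x y * y i := by
  intro x hx y hy
  unfold projChange
  rw [dX_add hU (hQ i) (hP.mul (SlitSmooth.fiber_coord i)) hx hy,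
    dX_mul_fiber hU hP (fun y => y i) hx hy]

theorem dX_dY_projChange (hU : IsOpen U) (hQ : ∀ i, SlitSmooth U (Q i)) (hP : SlitSmooth U P)
    (i k m : Fin n) : SlitEq U (dX m (dY k (projChange Q P i)))
      fun x y => dX m (dY k (Q i)) x y + (dX m P x y * kron i k + dX m (dY k P) x y * y i) := by
  intro x hx y hy
  have hc : SlitSmooth U fun (_ : E n) (_ : E n) => kron i k := SlitSmooth.const _
  rw [(dY_projChange hU hQ hP i k).dX_eq hU m x hx y hy,
    dX_add hU ((hQ i).dY hU k) ((hP.mul hc).add ((hP.dY hU k).mul (SlitSmooth.fiber_coord i)))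
      hx hy,
    dX_add hU (hP.mul hc) ((hP.dY hU k).mul (SlitSmooth.fiber_coord i)) hx hy,
    dX_mul_fiber hU hP (fun _ => kron i k) hx hy,
    dX_mul_fiber hU (hP.dY hU k) (fun y => y i) hx hy]

/-- Contraction with $y$ collapses every term by homogeneity: $P_{.k}y^k = P$, second vertical
derivatives of $P$ contract to zero, and $Q^m{}_{.k}y^k = 2Q^m$. -/
theorem sum_projTau_mul (hU : IsOpen U) (hQ : ∀ i, SlitSmooth U (Q i)) (hP : SlitSmooth U P)
    (hQ2 : ∀ i, SlitHomog U 2 (Q i)) (hP1 : SlitHomog U 1 P) (hx : x ∈ U) (hy : y ≠ 0) :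
    ∑ k, projTau Q P k x y * y k =
      (∑ m, dX m P x y * y m) - 2 * (∑ m, Q m x y * dY m P x y) - P x y ^ 2 := by
  have e1 : SlitEq U (fun x y => ∑ k, dY k P x y * y k) P := fun x hx y hy => by
    simpa using hP1.euler hU hP hx hy
  have hs : ∀ k, SlitSmooth U fun x y => dY k P x y * y k :=
    fun k => (hP.dY hU k).mul (SlitSmooth.fiber_coord k)
  -- The contraction is over the inner index, so Euler's identity for $P$ is itself differentiated,
  -- here and in `e3`; this avoids any appeal to the symmetry of second derivatives.
  have e2 : ∀ m, ∑ k, dX m (dY k P) x y * y k = dX m P x y := fun m => by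
    rw [← e1.dX_eq hU m x hx y hy, dX_sum hU hs hx hy]
    exact Finset.sum_congr rfl fun k _ =>
      (dX_mul_fiber hU (hP.dY hU k) (fun y => y k) hx hy m).symm
  have e3 : ∀ m, ∑ k, dY m (dY k P) x y * y k = 0 := fun m => by
    have h := e1.dY_eq m x hx y hy
    rw [dY_sum hU hs hx hy] at h
    simp only [dY_mul hU (hP.dY hU _) (SlitSmooth.fiber_coord _) hx hy, dY_coord,
      Finset.sum_add_distrib, sum_mul_kron] at h
    linarith
  have e4 : ∀ m, ∑ k, dY k (Q m) x y * y k = 2 * Q m x y := fun m => by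
    simpa using (hQ2 m).euler hU (hQ m) hx hy
  have s1 : ∑ k, (∑ m, dX m (dY k P) x y * y m) * y k = ∑ m, dX m P x y * y m := by
    simp only [Finset.sum_mul]
    rw [Finset.sum_comm]
    refine Finset.sum_congr rfl fun m _ => ?_
    rw [← e2 m, Finset.sum_mul]
    exact Finset.sum_congr rfl fun k _ => by ring
  have s2 : ∑ k, (∑ m, Q m x y * dY m (dY k P) x y) * y k = 0 := by
    simp only [Finset.sum_mul]
    rw [Finset.sum_comm]
    refine Finset.sum_eq_zero fun m _ => ?_
    simp only [mul_assoc, ← Finset.mul_sum, e3 m, mul_zero]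
  have s3 : ∑ k, (∑ m, dY m P x y * dY k (Q m) x y) * y k
      = 2 * ∑ m, Q m x y * dY m P x y := by
    simp only [Finset.sum_mul]
    rw [Finset.sum_comm, Finset.mul_sum]
    refine Finset.sum_congr rfl fun m _ => ?_
    simp only [mul_assoc, ← Finset.mul_sum, e4 m]
    ring
  have s4 : ∑ k, P x y * dY k P x y * y k = P x y ^ 2 := by
    simp only [mul_assoc, ← Finset.mul_sum]
    rw [show ∑ k, dY k P x y * y k = P x y from e1 x hx y hy, sq]
  have s5 : ∑ k, 2 * dX k P x y * y k = 2 * ∑ k, dX k P x y * y k := by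
    simp only [mul_assoc, ← Finset.mul_sum]
  have s6 : ∑ k, 2 * (∑ m, Q m x y * dY m (dY k P) x y) * y k = 0 := by
    simp only [mul_assoc, ← Finset.mul_sum] at s2 ⊢
    rw [s2, mul_zero]
  simp only [projTau, sub_mul, add_mul, Finset.sum_sub_distrib, Finset.sum_add_distrib]
  rw [s1, s3, s4, s5, s6]
  ring

theorem riem_projChange (hU : IsOpen U) (hQ : ∀ i, SlitSmooth U (Q i)) (hP : SlitSmooth U P)
    (hQ2 : ∀ i, SlitHomog U 2 (Q i)) (hP1 : SlitHomog U 1 P) (hx : x ∈ U) (hy : y ≠ 0)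
    (i k : Fin n) :
    riem (projChange Q P) i k x y = riem Q i k x y + projTau Q P k x y * y i
      - (∑ m, projTau Q P m x y * y m) * kron i k := by
  -- Euler's identity in degrees 1, 0, 2, 1 for $P$, $P_{.k}$, $Q^i$, $Q^i{}_{.k}$ evaluates all
  -- terms where the added $Py^m$ or $P_{.k}y^m$ is contracted with a vertical derivative.
  have e1 : ∑ m, dY m P x y * y m = P x y := by simpa using hP1.euler hU hP hx hy
  have e2 : ∑ m, dY m (dY k P) x y * y m = 0 := by
    simpa using (hP1.dY hU hP k).euler hU (hP.dY hU k) hx hy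
  have e3 : ∑ m, dY m (Q i) x y * y m = 2 * Q i x y := by
    simpa using (hQ2 i).euler hU (hQ i) hx hy
  have e4 : ∑ m, dY m (dY k (Q i)) x y * y m = dY k (Q i) x y := by
    simpa using (((hQ2 i).dY hU (hQ i) k).cast (by norm_num : (2 - 1 : ℤ) = 1)).euler hU
      ((hQ i).dY hU k) hx hy
  have s1 : ∑ m, dX m (dY k (projChange Q P i)) x y * y m
      = (∑ m, dX m (dY k (Q i)) x y * y m) + (∑ m, dX m P x y * y m) * kron i k
        + (∑ m, dX m (dY k P) x y * y m) * y i := by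
    simp only [dX_dY_projChange hU hQ hP i k _ x hx y hy, Finset.sum_mul,
      ← Finset.sum_add_distrib]
    exact Finset.sum_congr rfl fun m _ => by ring
  have s2 : ∑ m, projChange Q P m x y * dY m (dY k (projChange Q P i)) x y
      = (∑ m, Q m x y * dY m (dY k (Q i)) x y) + (∑ m, Q m x y * dY m P x y) * kron i k
        + dY k P x y * Q i x y + (∑ m, Q m x y * dY m (dY k P) x y) * y i
        + P x y * (dY k (Q i) x y + P x y * kron i k + dY k P x y * y i) := by
    have h : ∀ m, projChange Q P m x y * dY m (dY k (projChange Q P i)) x y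
        = Q m x y * dY m (dY k (Q i)) x y + Q m x y * dY m P x y * kron i k
          + dY k P x y * (Q m x y * kron i m) + Q m x y * dY m (dY k P) x y * y i
          + P x y * (dY m (dY k (Q i)) x y * y m + dY m P x y * y m * kron i k
            + dY k P x y * (y m * kron i m) + dY m (dY k P) x y * y m * y i) := fun m => by
      rw [dY_dY_projChange hU hQ hP i k m x hx y hy, projChange]
      ring
    simp only [h, Finset.sum_add_distrib, ← Finset.mul_sum, ← Finset.sum_mul, sum_mul_kron',
      e1, e2, e4]
    ring
  have s3 : ∑ m, dY m (projChange Q P i) x y * dY k (projChange Q P m) x y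
      = (∑ m, dY m (Q i) x y * dY k (Q m) x y) + 2 * P x y * dY k (Q i) x y
        + 2 * Q i x y * dY k P x y + (∑ m, dY m P x y * dY k (Q m) x y) * y i
        + P x y ^ 2 * kron i k + 3 * P x y * dY k P x y * y i := by
    have h : ∀ m, dY m (projChange Q P i) x y * dY k (projChange Q P m) x y
        = dY m (Q i) x y * dY k (Q m) x y + P x y * (dY m (Q i) x y * kron m k)
          + dY k P x y * (dY m (Q i) x y * y m) + P x y * (dY k (Q m) x y * kron i m)
          + P x y ^ 2 * (kron i m * kron m k) + P x y * dY k P x y * (y m * kron i m)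
          + dY m P x y * dY k (Q m) x y * y i + P x y * (dY m P x y * kron m k) * y i
          + dY k P x y * (dY m P x y * y m) * y i := fun m => by
      rw [dY_projChange hU hQ hP i m x hx y hy, dY_projChange hU hQ hP m k x hx y hy]
      ring
    simp only [h, Finset.sum_add_distrib, ← Finset.mul_sum, ← Finset.sum_mul, sum_mul_kron',
      sum_mul_kron, e1, e3]
    ring
  rw [sum_projTau_mul hU hQ hP hQ2 hP1 hx hy]
  simp only [riem, s1, s2, s3, projTau, dX_projChange hU hQ hP _ _ x hx y hy]
  ring

/-- The trace of `riem` changes by $\tau_my^m - n\,\tau_my^m$, and the division by $n-1$ leaves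
exactly $-\tau_my^m$. -/
theorem ricScalar_projChange (hn : 2 ≤ n) (hU : IsOpen U) (hQ : ∀ i, SlitSmooth U (Q i))
    (hP : SlitSmooth U P) (hQ2 : ∀ i, SlitHomog U 2 (Q i)) (hP1 : SlitHomog U 1 P) (hx : x ∈ U)
    (hy : y ≠ 0) :
    ricScalar (projChange Q P) x y = ricScalar Q x y - ∑ m, projTau Q P m x y * y m := by
  have hn' : (n : ℝ) - 1 ≠ 0 := by
    have : (2 : ℝ) ≤ n := by exact_mod_cast hn
    linarith
  simp only [ricScalar, riem_projChange hU hQ hP hQ2 hP1 hx hy, kron_self,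
    Finset.sum_sub_distrib, Finset.sum_add_distrib, Finset.sum_const, Finset.card_univ,
    Fintype.card_fin, nsmul_eq_mul]
  field_simp
  ring

/-- The normalization of the trace makes the two $\delta^i_k$ contributions cancel, so only the
rank-one term survives. -/
theorem aTensor_projChange (hn : 2 ≤ n) (hU : IsOpen U) (hQ : ∀ i, SlitSmooth U (Q i))
    (hP : SlitSmooth U P) (hQ2 : ∀ i, SlitHomog U 2 (Q i)) (hP1 : SlitHomog U 1 P) (i k : Fin n) :
    SlitEq U (aTensor (projChange Q P) i k)
      fun x y => aTensor Q i k x y + projTau Q P k x y * y i := by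
  intro x hx y hy
  simp only [aTensor, riem_projChange hU hQ hP hQ2 hP1 hx hy,
    ricScalar_projChange hn hU hQ hP hQ2 hP1 hx hy]
  ring

/-- The Weyl curvature is a projective invariant. -/
theorem weyl_projChange (hn : 2 ≤ n) (hU : IsOpen U) (hQ : ∀ i, SlitSmooth U (Q i))
    (hP : SlitSmooth U P) (hQ2 : ∀ i, SlitHomog U 2 (Q i)) (hP1 : SlitHomog U 1 P) (i k : Fin n) :
    SlitEq U (weyl (projChange Q P) i k) (weyl Q i k) := by
  intro x hx y hy
  have hτ := SlitSmooth.projTau hU hQ hP k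
  have e : ∑ m, dY m (projTau Q P k) x y * y m = projTau Q P k x y := by
    simpa using (SlitHomog.projTau hU hQ hP hQ2 hP1 k).euler hU hτ hx hy
  -- The divergence of $\tau_ky^m$ is $n\tau_k + \tau_{k.m}y^m = (n+1)\tau_k$, since $\tau_k$ has
  -- degree 1; this explains the factor $1/(n+1)$ in the Weyl curvature.
  have s : ∑ m, dY m (aTensor (projChange Q P) m k) x y
      = (∑ m, dY m (aTensor Q m k) x y) + (n + 1) * projTau Q P k x y := by
    have : ∀ m, dY m (aTensor (projChange Q P) m k) x y = dY m (aTensor Q m k) x y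
        + (projTau Q P k x y + dY m (projTau Q P k) x y * y m) := fun m => by
      rw [(aTensor_projChange hn hU hQ hP hQ2 hP1 m k).dY_eq m x hx y hy,
        dY_add hU (SlitSmooth.aTensor hU hQ m k) (hτ.mul (SlitSmooth.fiber_coord m)) hx hy,
        dY_mul hU hτ (SlitSmooth.fiber_coord m) hx hy, dY_coord, kron_self, mul_one]
    simp only [this, Finset.sum_add_distrib, e, Finset.sum_const, Finset.card_univ,
      Fintype.card_fin, nsmul_eq_mul]
    ring
  simp only [weyl]
  rw [s, aTensor_projChange hn hU hQ hP hQ2 hP1 i k x hx y hy]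
  have : (n : ℝ) + 1 ≠ 0 := by positivity
  field_simp
  ring

end

section

variable {n : ℕ} {U : Set (E n)}

/-! ### Functions that are linear or quadratic on the fibres -/

/-- `f` is linear in `y`. -/
def FiberLinear (U : Set (E n)) (f : E n → E n → ℝ) : Prop :=
  ∃ c : Fin n → E n → ℝ, SlitEq U f fun x y => ∑ a, c a x * y a

/-- `f` is quadratic in `y`. -/
def FiberQuadratic (U : Set (E n)) (f : E n → E n → ℝ) : Prop :=
  ∃ c : Fin n → Fin n → E n → ℝ, SlitEq U f fun x y => ∑ a, ∑ b, c a b x * (y a * y b)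

variable {f g : E n → E n → ℝ}

namespace FiberLinear

theorem congr (hf : FiberLinear U f) (h : SlitEq U g f) : FiberLinear U g :=
  hf.imp fun _ hc => h.trans hc

theorem coord (i : Fin n) : FiberLinear U fun _ y => y i :=
  ⟨fun a _ => kron a i, fun _ _ y _ => (sum_kron_mul i fun a => y a).symm⟩

theorem inner : FiberLinear U fun x y => inner ℝ x y :=
  ⟨fun a x => x a, fun x _ y _ => inner_eq_sum x y⟩

theorem add (hf : FiberLinear U f) (hg : FiberLinear U g) :
    FiberLinear U fun x y => f x y + g x y := by
  obtain ⟨c, hc⟩ := hf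
  obtain ⟨d, hd⟩ := hg
  refine ⟨fun a x => c a x + d a x, fun x hx y hy => ?_⟩
  simp only [hc x hx y hy, hd x hx y hy, add_mul, Finset.sum_add_distrib]

theorem base_mul (b : E n → ℝ) (hf : FiberLinear U f) : FiberLinear U fun x y => b x * f x y := by
  obtain ⟨c, hc⟩ := hf
  refine ⟨fun a x => b x * c a x, fun x hx y hy => ?_⟩
  simp only [hc x hx y hy, Finset.mul_sum, mul_assoc]

theorem sub (hf : FiberLinear U f) (hg : FiberLinear U g) :
    FiberLinear U fun x y => f x y - g x y :=
  (hf.add (hg.base_mul fun _ => -1)).congr fun _ _ _ _ => by ring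

theorem mul (hf : FiberLinear U f) (hg : FiberLinear U g) :
    FiberQuadratic U fun x y => f x y * g x y := by
  obtain ⟨c, hc⟩ := hf
  obtain ⟨d, hd⟩ := hg
  refine ⟨fun a b x => c a x * d b x, fun x hx y hy => ?_⟩
  simp only [hc x hx y hy, hd x hx y hy, Finset.sum_mul_sum]
  exact Finset.sum_congr rfl fun a _ => Finset.sum_congr rfl fun b _ => by ring

/-- The second vertical derivatives of a fibrewise linear function vanish. -/
theorem dY_dY (hf : FiberLinear U f) (k l : Fin n) :
    SlitEq U (dY l (dY k f)) fun _ _ => 0 := by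
  obtain ⟨c, hc⟩ := hf
  have h : SlitEq U (dY k f) fun x _ => c k x := by
    refine (hc.dY_eq k).trans fun x _ y hy => ?_
    -- With $x$ frozen the coefficients are constants, so no regularity of them in $x$ is needed.
    have hs : ∀ a, SlitSmooth (Set.univ : Set (E n)) fun _ y => c a x * y a := fun a =>
      (SlitSmooth.const _).mul (SlitSmooth.fiber_coord a)
    have h1 : dY k (fun x y => ∑ a, c a x * y a) x y = dY k (fun _ y => ∑ a, c a x * y a) x y :=
      rfl
    rw [h1, dY_sum isOpen_univ hs trivial hy]
    simp only [dY_const_mul isOpen_univ _ (SlitSmooth.fiber_coord _) (Set.mem_univ x) hy,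
      dY_coord, sum_mul_kron]
  exact (h.dY_eq l).trans fun x _ y _ => dY_base _ l x y

end FiberLinear

namespace FiberQuadratic

theorem congr (hf : FiberQuadratic U f) (h : SlitEq U g f) : FiberQuadratic U g :=
  hf.imp fun _ hc => h.trans hc

theorem add (hf : FiberQuadratic U f) (hg : FiberQuadratic U g) :
    FiberQuadratic U fun x y => f x y + g x y := by
  obtain ⟨c, hc⟩ := hf
  obtain ⟨d, hd⟩ := hg
  refine ⟨fun a b x => c a b x + d a b x, fun x hx y hy => ?_⟩
  simp only [hc x hx y hy, hd x hx y hy, add_mul, Finset.sum_add_distrib]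

theorem base_mul (b : E n → ℝ) (hf : FiberQuadratic U f) :
    FiberQuadratic U fun x y => b x * f x y := by
  obtain ⟨c, hc⟩ := hf
  refine ⟨fun a a' x => b x * c a a' x, fun x hx y hy => ?_⟩
  simp only [hc x hx y hy, Finset.mul_sum, mul_assoc]

theorem sub (hf : FiberQuadratic U f) (hg : FiberQuadratic U g) :
    FiberQuadratic U fun x y => f x y - g x y :=
  (hf.add (hg.base_mul fun _ => -1)).congr fun _ _ _ _ => by ring

theorem norm_sq : FiberQuadratic U fun _ y => ‖y‖ ^ 2 := by
  refine ⟨fun a b _ => kron b a, fun x _ y _ => ?_⟩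
  beta_reduce
  rw [norm_sq_eq_sum]
  simp only [sum_kron_mul]

theorem dY (hf : FiberQuadratic U f) (k : Fin n) : FiberLinear U (dY k f) := by
  obtain ⟨c, hc⟩ := hf
  refine ⟨fun a x => c a k x + c k a x, (hc.dY_eq k).trans fun x _ y hy => ?_⟩
  have hs : ∀ a b, SlitSmooth (Set.univ : Set (E n)) fun _ y => c a b x * (y a * y b) :=
    fun a b => (SlitSmooth.const _).mul
      ((SlitSmooth.fiber_coord a).mul (SlitSmooth.fiber_coord b))
  have h1 : FinslerGeom.dY k (fun x y => ∑ a, ∑ b, c a b x * (y a * y b)) x y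
      = FinslerGeom.dY k (fun _ y => ∑ a, ∑ b, c a b x * (y a * y b)) x y := rfl
  rw [h1, dY_sum isOpen_univ (fun a => SlitSmooth.sum (hs a)) trivial hy]
  simp only [dY_sum isOpen_univ (hs _) (Set.mem_univ x) hy,
    dY_const_mul isOpen_univ _ ((SlitSmooth.fiber_coord _).mul (SlitSmooth.fiber_coord _))
      (Set.mem_univ x) hy,
    dY_mul isOpen_univ (SlitSmooth.fiber_coord _) (SlitSmooth.fiber_coord _) (Set.mem_univ x) hy,
    dY_coord, mul_add, add_mul, Finset.sum_add_distrib]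
  congr 1
  · refine Finset.sum_congr rfl fun a _ => ?_
    simp only [← mul_assoc, sum_mul_kron]
  · rw [Finset.sum_comm]
    refine Finset.sum_congr rfl fun b _ => ?_
    rw [← sum_kron_mul k fun a => c a b x * y b]
    exact Finset.sum_congr rfl fun a _ => by ring

/-- The third vertical derivatives of a fibrewise quadratic function vanish. -/
theorem dY_dY_dY (hf : FiberQuadratic U f) (j k l : Fin n) :
    SlitEq U (FinslerGeom.dY j (FinslerGeom.dY k (FinslerGeom.dY l f))) fun _ _ => 0 :=
  (hf.dY l).dY_dY k j

end FiberQuadratic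

/-- If the Weyl curvature is quadratic in `y`, then the weakly-Weyl curvature vanishes. -/
theorem weakWeyl_eq_zero_of_fiberQuadratic {G : Fin n → E n → E n → ℝ}
    (h : ∀ i k, FiberQuadratic U (weyl G i k)) (j i k l : Fin n) :
    SlitEq U (weakWeyl G j i k l) fun _ _ => 0 := by
  intro x hx y hy
  refine Finset.sum_eq_zero fun m _ => mul_eq_zero_of_left ?_ _
  have : FiberLinear U fun x y =>
      (1 / 3 : ℝ) * (dY l (weyl G i m) x y - dY m (weyl G i l) x y) :=
    (((h i m).dY l).sub ((h i l).dY m)).base_mul fun _ => 1 / 3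
  exact this.dY_dY j k x hx y hy

/-- A spray projectively equivalent to a quadratic one has vanishing Douglas curvature. -/
theorem douglas_projChange (hU : IsOpen U) {Q : Fin n → E n → E n → ℝ} {P : E n → E n → ℝ}
    (hQ : ∀ i, SlitSmooth U (Q i)) (hP : SlitSmooth U P) (hP1 : SlitHomog U 1 P)
    (hq : ∀ i, FiberQuadratic U (Q i))
    (hq' : ∀ i, FiberQuadratic U fun x y => (∑ m, dY m (Q m) x y) * y i) (j i k l : Fin n) :
    SlitEq U (douglas (projChange Q P) j i k l) fun _ _ => 0 := by
  have hPy : SlitSmooth U fun x y => P x y * y i := hP.mul (SlitSmooth.fiber_coord i)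
  have hdiv : SlitSmooth U fun x y => (∑ m, dY m (Q m) x y) * y i :=
    (SlitSmooth.sum fun m => (hQ m).dY hU m).mul (SlitSmooth.fiber_coord i)
  have c1 : SlitSmooth U fun (_ : E n) (_ : E n) => (n : ℝ) + 1 := SlitSmooth.const _
  have hcPy : SlitSmooth U fun x y => ((n : ℝ) + 1) * (P x y * y i) := c1.mul hPy
  -- By Euler's identity the divergence of $Py^m$ is $(n+1)P$. The correction term in the Douglas
  -- curvature therefore removes $Py^i$ entirely and leaves third derivatives of quadratics.
  have e : SlitEq U (fun x y => (∑ m, dY m (projChange Q P m) x y) * y i)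
      fun x y => (∑ m, dY m (Q m) x y) * y i + ((n : ℝ) + 1) * (P x y * y i) := by
    intro x hx y hy
    have e1 : ∑ m, dY m P x y * y m = P x y := by simpa using hP1.euler hU hP hx hy
    simp only [dY_projChange hU hQ hP _ _ x hx y hy, kron_self, Finset.sum_add_distrib, e1,
      Finset.sum_const, Finset.card_univ, Fintype.card_fin, nsmul_eq_mul, mul_one]
    ring
  have d3 : ∀ {f g : E n → E n → ℝ}, SlitSmooth U f → SlitSmooth U g →
      SlitEq U (dY j (dY k (dY l fun x y => f x y + g x y)))
        fun x y => dY j (dY k (dY l f)) x y + dY j (dY k (dY l g)) x y := by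
    intro f g hf hg
    have t1 : SlitEq U (dY l fun x y => f x y + g x y) fun x y => dY l f x y + dY l g x y :=
      fun x hx y hy => dY_add hU hf hg hx hy l
    have t2 : SlitEq U (dY k (dY l fun x y => f x y + g x y))
        fun x y => dY k (dY l f) x y + dY k (dY l g) x y :=
      (t1.dY_eq k).trans fun x hx y hy => dY_add hU (hf.dY hU l) (hg.dY hU l) hx hy k
    exact (t2.dY_eq j).trans fun x hx y hy =>
      dY_add hU ((hf.dY hU l).dY hU k) ((hg.dY hU l).dY hU k) hx hy j
  have c3 : SlitEq U (dY j (dY k (dY l fun x y => ((n : ℝ) + 1) * (P x y * y i))))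
      fun x y => ((n : ℝ) + 1) * dY j (dY k (dY l fun x y => P x y * y i)) x y := by
    have t1 : SlitEq U (dY l fun x y => ((n : ℝ) + 1) * (P x y * y i))
        fun x y => ((n : ℝ) + 1) * dY l (fun x y => P x y * y i) x y :=
      fun x hx y hy => dY_const_mul hU _ hPy hx hy l
    have t2 : SlitEq U (dY k (dY l fun x y => ((n : ℝ) + 1) * (P x y * y i)))
        fun x y => ((n : ℝ) + 1) * dY k (dY l fun x y => P x y * y i) x y :=
      (t1.dY_eq k).trans fun x hx y hy => dY_const_mul hU _ (hPy.dY hU l) hx hy k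
    exact (t2.dY_eq j).trans fun x hx y hy => dY_const_mul hU _ ((hPy.dY hU l).dY hU k) hx hy j
  intro x hx y hy
  have a1 := d3 (hQ i) hPy x hx y hy
  have a2 := d3 hdiv hcPy x hx y hy
  beta_reduce at a1 a2
  rw [(hq i).dY_dY_dY j k l x hx y hy] at a1
  rw [(hq' i).dY_dY_dY j k l x hx y hy, c3 x hx y hy,
    ← ((e.dY_eq l).dY_eq k).dY_eq j x hx y hy] at a2
  have a1' : dY j (dY k (dY l (projChange Q P i))) x y
      = 0 + dY j (dY k (dY l fun x y => P x y * y i)) x y := a1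
  have : (n : ℝ) + 1 ≠ 0 := by positivity
  simp only [douglas]
  rw [a1', a2]
  field_simp
  ring

/-! ### The quadratic spray `Qⁱ = q(x) |y|² xⁱ` -/

/-- The quadratic spray coefficients `q(x) |y|² xⁱ`. -/
def radialSpray (q : E n → ℝ) (i : Fin n) : E n → E n → ℝ := fun x y => q x * x i * ‖y‖ ^ 2

variable {q q₁ : E n → ℝ}

theorem SlitSmooth.norm_sq : SlitSmooth U fun _ y => ‖y‖ ^ 2 := SlitSmooth.norm.pow 2

theorem SlitSmooth.radialSpray (hq : ContDiffOn ℝ ∞ q U) (i : Fin n) :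
    SlitSmooth U (radialSpray q i) :=
  ((SlitSmooth.base hq).mul (SlitSmooth.base_coord i)).mul SlitSmooth.norm_sq

theorem SlitHomog.radialSpray (i : Fin n) : SlitHomog U 2 (radialSpray q i) := by
  intro x _ y _ c hc
  simp only [FinslerGeom.radialSpray, norm_smul, Real.norm_eq_abs, abs_of_pos hc]
  norm_cast
  ring

theorem FiberQuadratic.radialSpray (i : Fin n) : FiberQuadratic U (radialSpray q i) :=
  FiberQuadratic.norm_sq.base_mul fun x => q x * x i

theorem dY_radialSpray (hU : IsOpen U) (i k : Fin n) :
    SlitEq U (dY k (radialSpray q i)) fun x y => q x * x i * (2 * y k) := by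
  intro x hx y hy
  unfold radialSpray
  rw [dY_base_mul hU (fun x => q x * x i) SlitSmooth.norm_sq hx hy, dY_norm_sq]

theorem dY_dY_radialSpray (hU : IsOpen U) (i k m : Fin n) :
    SlitEq U (dY m (dY k (radialSpray q i))) fun x _ => q x * x i * (2 * kron k m) := by
  intro x hx y hy
  rw [(dY_radialSpray hU i k).dY_eq m x hx y hy,
    dY_base_mul hU (fun x => q x * x i) ((SlitSmooth.const 2).mul (SlitSmooth.fiber_coord k))
      hx hy,
    dY_const_mul hU 2 (SlitSmooth.fiber_coord k) hx hy, dY_coord]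

/-- The divergence of the radial spray is $2q\langle x,y\rangle$, which is linear on fibres. -/
theorem FiberQuadratic.div_radialSpray_mul (hU : IsOpen U) (i : Fin n) :
    FiberQuadratic U fun x y => (∑ m, FinslerGeom.dY m (FinslerGeom.radialSpray q m) x y) * y i := by
  refine ((FiberLinear.inner.base_mul fun x => 2 * q x).mul (FiberLinear.coord i)).congr ?_
  intro x hx y hy
  simp only [dY_radialSpray hU _ _ x hx y hy, inner_eq_sum, Finset.mul_sum]
  congr 1
  exact Finset.sum_congr rfl fun m _ => by ring

/-- The hypothesis on `q₁` is the infinitesimal form of $q$ being radial. The last summand looks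
like constant curvature and will drop out of the Weyl tensor; the first carries the factor
$2q_1+4q^2$. -/
theorem riem_radialSpray (hU : IsOpen U) (hq : ContDiffOn ℝ ∞ q U)
    (hq₁ : ∀ x ∈ U, ∀ k, fderiv ℝ q x (stdVec k) = q₁ x * x k) (i k : Fin n) :
    SlitEq U (riem (radialSpray q) i k) fun x y =>
      (2 * q₁ x + 4 * q x ^ 2) * x i * (‖y‖ ^ 2 * x k - inner ℝ x y * y k)
        + 2 * q x * (‖y‖ ^ 2 * kron i k - y i * y k) := by
  intro x hx y hy
  have hb : SlitSmooth U fun x _ => q x * x i :=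
    (SlitSmooth.base hq).mul (SlitSmooth.base_coord i)
  have dq : ∀ m, dX m (fun x _ => q x * x i) x y = q x * kron i m + q₁ x * x m * x i := by
    intro m
    rw [dX_mul hU (SlitSmooth.base hq) (SlitSmooth.base_coord i) hx hy, dX_coord,
      ← hq₁ x hx m]
    rfl
  have t1 : ∀ m, dX m (radialSpray q i) x y
      = (q x * kron i m + q₁ x * x m * x i) * ‖y‖ ^ 2 := fun m => by
    rw [← dq]
    exact dX_mul_fiber hU hb (fun y => ‖y‖ ^ 2) hx hy m
  have t2 : ∀ m, dX m (dY k (radialSpray q i)) x y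
      = (q x * kron i m + q₁ x * x m * x i) * (2 * y k) := fun m => by
    rw [(dY_radialSpray hU i k).dX_eq hU m x hx y hy, ← dq]
    exact dX_mul_fiber hU hb (fun y => 2 * y k) hx hy m
  have ip := inner_eq_sum x y
  have s1 : ∑ m, dX m (dY k (radialSpray q i)) x y * y m
      = (q x * y i + q₁ x * inner ℝ x y * x i) * (2 * y k) := by
    have h : ∀ m, dX m (dY k (radialSpray q i)) x y * y m
        = 2 * y k * q x * (y m * kron i m) + 2 * y k * q₁ x * x i * (x m * y m) := fun m => by
      rw [t2]; ring
    simp only [h, Finset.sum_add_distrib, ← Finset.mul_sum, sum_mul_kron', ← ip]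
    ring
  have s2 : ∑ m, radialSpray q m x y * dY m (dY k (radialSpray q i)) x y
      = 2 * q x ^ 2 * ‖y‖ ^ 2 * x i * x k := by
    have h : ∀ m, radialSpray q m x y * dY m (dY k (radialSpray q i)) x y
        = 2 * q x ^ 2 * ‖y‖ ^ 2 * x i * (x m * kron k m) := fun m => by
      rw [dY_dY_radialSpray hU i k m x hx y hy, radialSpray]; ring
    simp only [h, ← Finset.mul_sum, sum_mul_kron']
  have s3 : ∑ m, dY m (radialSpray q i) x y * dY k (radialSpray q m) x y
      = 4 * q x ^ 2 * x i * y k * inner ℝ x y := by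
    have h : ∀ m, dY m (radialSpray q i) x y * dY k (radialSpray q m) x y
        = 4 * q x ^ 2 * x i * y k * (x m * y m) := fun m => by
      rw [dY_radialSpray hU i m x hx y hy, dY_radialSpray hU m k x hx y hy]; ring
    simp only [h, ← Finset.mul_sum, ← ip]
  simp only [riem, t1, s1, s2, s3]
  ring

theorem ricScalar_radialSpray (hn : 2 ≤ n) (hU : IsOpen U) (hq : ContDiffOn ℝ ∞ q U)
    (hq₁ : ∀ x ∈ U, ∀ k, fderiv ℝ q x (stdVec k) = q₁ x * x k) :
    SlitEq U (ricScalar (radialSpray q)) fun x y =>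
      (2 * q₁ x + 4 * q x ^ 2) / (n - 1) * (‖x‖ ^ 2 * ‖y‖ ^ 2 - inner ℝ x y ^ 2)
        + 2 * q x * ‖y‖ ^ 2 := by
  intro x hx y hy
  have hn' : (n : ℝ) - 1 ≠ 0 := by
    have : (2 : ℝ) ≤ n := by exact_mod_cast hn
    linarith
  have h : ∀ m, riem (radialSpray q) m m x y
      = (2 * q₁ x + 4 * q x ^ 2) * ‖y‖ ^ 2 * (x m * x m)
        - (2 * q₁ x + 4 * q x ^ 2) * inner ℝ x y * (x m * y m)
        + (2 * q x * ‖y‖ ^ 2 - 2 * q x * (y m * y m)) := fun m => by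
    rw [riem_radialSpray hU hq hq₁ m m x hx y hy, kron_self]; ring
  simp only [ricScalar, h, Finset.sum_add_distrib, Finset.sum_sub_distrib, ← Finset.mul_sum,
    ← norm_sq_eq_sum, ← inner_eq_sum, Finset.sum_const, Finset.card_univ, Fintype.card_fin,
    nsmul_eq_mul]
  field_simp

theorem aTensor_radialSpray (hn : 2 ≤ n) (hU : IsOpen U) (hq : ContDiffOn ℝ ∞ q U)
    (hq₁ : ∀ x ∈ U, ∀ k, fderiv ℝ q x (stdVec k) = q₁ x * x k) (i k : Fin n) :
    SlitEq U (aTensor (radialSpray q) i k) fun x y =>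
      ((2 * q₁ x + 4 * q x ^ 2) * (x i * x k - ‖x‖ ^ 2 / (n - 1) * kron i k) * ‖y‖ ^ 2
        - (2 * q₁ x + 4 * q x ^ 2) * x i * (inner ℝ x y * y k))
        + ((2 * q₁ x + 4 * q x ^ 2) / (n - 1) * kron i k * (inner ℝ x y * inner ℝ x y)
          - 2 * q x * (y i * y k)) := by
  intro x hx y hy
  simp only [aTensor]
  rw [riem_radialSpray hU hq hq₁ i k x hx y hy, ricScalar_radialSpray hn hU hq hq₁ x hx y hy]
  ring

/-- The part of $A^i{}_k$ without the factor $2q_1+4q^2$ is $-2q\,y^iy^k$, which the divergence term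
cancels. The result is thus a multiple of this single radial factor and is quadratic in $y$. -/
theorem weyl_radialSpray (hn : 2 ≤ n) (hU : IsOpen U) (hq : ContDiffOn ℝ ∞ q U)
    (hq₁s : ContDiffOn ℝ ∞ q₁ U)
    (hq₁ : ∀ x ∈ U, ∀ k, fderiv ℝ q x (stdVec k) = q₁ x * x k) (i k : Fin n) :
    SlitEq U (weyl (radialSpray q) i k) fun x y =>
      (2 * q₁ x + 4 * q x ^ 2) * ((x i * x k - ‖x‖ ^ 2 / (n - 1) * kron i k) * ‖y‖ ^ 2
        - x i * (inner ℝ x y * y k) + 1 / (n - 1) * kron i k * (inner ℝ x y * inner ℝ x y)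
        - 1 / (n - 1) * x k * (inner ℝ x y * y i) + ‖x‖ ^ 2 / (n - 1) * (y i * y k)) := by
  intro x hx y hy
  have hn' : (n : ℝ) - 1 ≠ 0 := by
    have : (2 : ℝ) ≤ n := by exact_mod_cast hn
    linarith
  have hκ : SlitSmooth U fun x _ => 2 * q₁ x + 4 * q x ^ 2 :=
    ((SlitSmooth.const 2).mul (SlitSmooth.base hq₁s)).add
      ((SlitSmooth.const 4).mul ((SlitSmooth.base hq).pow 2))
  have hns : SlitSmooth U fun x _ => ‖x‖ ^ 2 := SlitSmooth.base (contDiff_norm_sq ℝ).contDiffOn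
  have div : ∀ m, dY m (aTensor (radialSpray q) m k) x y
      = (2 * q₁ x + 4 * q x ^ 2) * (x m * x k - ‖x‖ ^ 2 / (n - 1) * kron m k) * (2 * y m)
        - (2 * q₁ x + 4 * q x ^ 2) * x m * (inner ℝ x y * kron k m + x m * y k)
        + ((2 * q₁ x + 4 * q x ^ 2) / (n - 1) * kron m k * (2 * inner ℝ x y * x m)
          - 2 * q x * (y m * kron k m + y k)) := fun m => by
    have b1 : SlitSmooth U fun x _ =>
        (2 * q₁ x + 4 * q x ^ 2) * (x m * x k - ‖x‖ ^ 2 / (n - 1) * kron m k) := by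
      refine hκ.mul (((SlitSmooth.base_coord m).mul (SlitSmooth.base_coord k)).sub ?_)
      exact (hns.mul (SlitSmooth.const _)).mul (SlitSmooth.const _)
    have b2 : SlitSmooth U fun x _ => (2 * q₁ x + 4 * q x ^ 2) * x m :=
      hκ.mul (SlitSmooth.base_coord m)
    have b3 : SlitSmooth U fun x _ => (2 * q₁ x + 4 * q x ^ 2) / (n - 1) * kron m k :=
      (hκ.mul (SlitSmooth.const _)).mul (SlitSmooth.const _)
    have b4 : SlitSmooth U fun x _ => 2 * q x := (SlitSmooth.const 2).mul (SlitSmooth.base hq)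
    have f2 : SlitSmooth U fun x y => inner ℝ x y * y k :=
      SlitSmooth.inner.mul (SlitSmooth.fiber_coord k)
    have f3 : SlitSmooth U fun x y => inner ℝ x y * inner ℝ x y :=
      SlitSmooth.inner.mul SlitSmooth.inner
    have f4 : SlitSmooth U fun (_ : E n) y => y m * y k :=
      (SlitSmooth.fiber_coord m).mul (SlitSmooth.fiber_coord k)
    rw [(aTensor_radialSpray hn hU hq hq₁ m k).dY_eq m x hx y hy,
      dY_add hU ((b1.mul SlitSmooth.norm_sq).sub (b2.mul f2)) ((b3.mul f3).sub (b4.mul f4)) hx hy,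
      dY_sub hU (b1.mul SlitSmooth.norm_sq) (b2.mul f2) hx hy,
      dY_sub hU (b3.mul f3) (b4.mul f4) hx hy,
      dY_base_mul hU (fun x =>
        (2 * q₁ x + 4 * q x ^ 2) * (x m * x k - ‖x‖ ^ 2 / (n - 1) * kron m k))
        SlitSmooth.norm_sq hx hy,
      dY_base_mul hU (fun x => (2 * q₁ x + 4 * q x ^ 2) * x m) f2 hx hy,
      dY_base_mul hU (fun x => (2 * q₁ x + 4 * q x ^ 2) / (n - 1) * kron m k) f3 hx hy,
      dY_base_mul hU (fun x => 2 * q x) f4 hx hy,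
      dY_mul hU SlitSmooth.inner (SlitSmooth.fiber_coord k) hx hy,
      dY_mul hU SlitSmooth.inner SlitSmooth.inner hx hy,
      dY_mul hU (SlitSmooth.fiber_coord m) (SlitSmooth.fiber_coord k) hx hy,
      dY_norm_sq, dY_inner, dY_coord, dY_coord, kron_self]
    ring
  have s : ∑ m, dY m (aTensor (radialSpray q) m k) x y
      = (n + 1) * ((2 * q₁ x + 4 * q x ^ 2) / (n - 1) * (inner ℝ x y * x k - ‖x‖ ^ 2 * y k)
        - 2 * q x * y k) := by
    have h : ∀ m, dY m (aTensor (radialSpray q) m k) x y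
        = 2 * (2 * q₁ x + 4 * q x ^ 2) * x k * (x m * y m)
          - 2 * (2 * q₁ x + 4 * q x ^ 2) * (‖x‖ ^ 2 / (n - 1)) * (y m * kron m k)
          - (2 * q₁ x + 4 * q x ^ 2) * inner ℝ x y * (x m * kron k m)
          - (2 * q₁ x + 4 * q x ^ 2) * y k * (x m * x m)
          + 2 * (2 * q₁ x + 4 * q x ^ 2) / (n - 1) * inner ℝ x y * (x m * kron m k)
          - 2 * q x * (y m * kron k m) - 2 * q x * y k := fun m => by
      rw [div]; ring
    simp only [h, Finset.sum_add_distrib, Finset.sum_sub_distrib, ← Finset.mul_sum,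
      ← norm_sq_eq_sum, ← inner_eq_sum, sum_mul_kron, sum_mul_kron', Finset.sum_const,
      Finset.card_univ, Fintype.card_fin, nsmul_eq_mul]
    field_simp
    ring
  simp only [weyl]
  rw [s, aTensor_radialSpray hn hU hq hq₁ i k x hx y hy]
  have : (n : ℝ) + 1 ≠ 0 := by positivity
  field_simp
  ring

theorem FiberQuadratic.weyl_radialSpray (hn : 2 ≤ n) (hU : IsOpen U) (hq : ContDiffOn ℝ ∞ q U)
    (hq₁s : ContDiffOn ℝ ∞ q₁ U)
    (hq₁ : ∀ x ∈ U, ∀ k, fderiv ℝ q x (stdVec k) = q₁ x * x k) (i k : Fin n) :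
    FiberQuadratic U (weyl (FinslerGeom.radialSpray q) i k) := by
  refine FiberQuadratic.congr ?_ (FinslerGeom.weyl_radialSpray hn hU hq hq₁s hq₁ i k)
  have ip : FiberLinear U fun x y => inner ℝ x y := FiberLinear.inner
  have co : ∀ i, FiberLinear U fun _ y => y i := FiberLinear.coord
  exact (((((FiberQuadratic.norm_sq.base_mul fun x =>
    x i * x k - ‖x‖ ^ 2 / (n - 1) * kron i k).sub ((ip.mul (co k)).base_mul fun x => x i)).add
    ((ip.mul ip).base_mul fun _ => 1 / (n - 1) * kron i k)).sub
    ((ip.mul (co i)).base_mul fun x => 1 / (n - 1) * x k)).add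
    (((co i).mul (co k)).base_mul fun x => ‖x‖ ^ 2 / (n - 1))).base_mul
      fun x => 2 * q₁ x + 4 * q x ^ 2

end

section

variable {n : ℕ} {U : Set (E n)}

/-! ### Second derivatives along lines -/

theorem SlitSmooth.hasDerivAt_line (hU : IsOpen U) {f : E n → E n → ℝ} (hf : SlitSmooth U f)
    {x v w : E n} {s : ℝ} (hx : x ∈ U) (hv : v + s • w ≠ 0) :
    HasDerivAt (fun t : ℝ => f x (v + t • w)) (∑ m, FinslerGeom.dY m f x (v + s • w) * w m) s := by
  have h1 : HasDerivAt (fun t : ℝ => v + t • w) w s := by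
    simpa using ((hasDerivAt_id s).smul_const w).const_add v
  have h2 := (hf.differentiableAt_fiber hU hx hv).hasFDerivAt.comp_hasDerivAt s h1
  rw [fderiv_apply_eq_sum] at h2
  exact h2

/-- Links the iterated line derivative in the definition of a Finsler metric to the vertical Hessian
in coordinates. -/
theorem SlitSmooth.deriv_deriv_line (hU : IsOpen U) {f : E n → E n → ℝ} (hf : SlitSmooth U f)
    {x v : E n} (w : E n) (hx : x ∈ U) (hv : v ≠ 0) :
    deriv (fun s : ℝ => deriv (fun t : ℝ => f x (v + s • w + t • w)) 0) 0
      = ∑ i, w i * ∑ j, FinslerGeom.dY i (FinslerGeom.dY j f) x v * w j := by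
  have hc : ContinuousAt (fun s : ℝ => v + s • w) 0 := by fun_prop
  have h1 : ∀ᶠ s : ℝ in 𝓝 0, v + s • w ≠ 0 :=
    hc.eventually_ne (by simpa using hv)
  have h2 : (fun s : ℝ => deriv (fun t : ℝ => f x (v + s • w + t • w)) 0)
      =ᶠ[𝓝 0] fun s => ∑ j, FinslerGeom.dY j f x (v + s • w) * w j := by
    filter_upwards [h1] with s hs
    have := (hf.hasDerivAt_line hU (v := v + s • w) (w := w) (s := 0) hx (by simpa using hs)).deriv
    simpa using this
  have hv' : v + (0 : ℝ) • w ≠ 0 := by simpa using hv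
  rw [h2.deriv_eq, (HasDerivAt.fun_sum fun j _ =>
    ((hf.dY hU j).hasDerivAt_line hU hx hv').mul_const (w j)).deriv]
  simp only [zero_smul, add_zero, Finset.sum_mul, Finset.mul_sum]
  rw [Finset.sum_comm]
  exact Finset.sum_congr rfl fun i _ => Finset.sum_congr rfl fun j _ => by ring

/-! ### Randers metrics `u(x) |y| + h(x) ⟨x, y⟩` -/

/-- The Randers metric `u(x) |y| + h(x) ⟨x, y⟩`. -/
def randers (u h : E n → ℝ) : E n → E n → ℝ := fun x y => u x * ‖y‖ + h x * inner ℝ x y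

variable {u h : E n → ℝ} {x y v : E n}

theorem randers_pos (hlt : |h x| * ‖x‖ < u x) (hy : y ≠ 0) : 0 < randers u h x y := by
  have hy' : 0 < ‖y‖ := norm_pos_iff.2 hy
  have h1 : |h x * inner ℝ x y| ≤ |h x| * ‖x‖ * ‖y‖ := by
    rw [abs_mul, mul_assoc]
    exact mul_le_mul_of_nonneg_left (abs_real_inner_le_norm x y) (abs_nonneg _)
  have h2 := mul_lt_mul_of_pos_right hlt hy'
  have h3 := neg_abs_le (h x * inner ℝ x y)
  unfold randers
  linarith

theorem randers_smul {c : ℝ} (hc : 0 < c) : randers u h x (c • y) = c * randers u h x y := by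
  simp only [randers, norm_smul, inner_smul_right, Real.norm_eq_abs, abs_of_pos hc]
  ring

/-- Positivity of the quadratic form of the fundamental tensor of a Randers metric. -/
theorem randers_form_pos (hlt : |h x| * ‖x‖ < u x) (hy : y ≠ 0) (hv : v ≠ 0) :
    0 < (u x * (inner ℝ y v * ‖y‖⁻¹) + h x * inner ℝ x v) ^ 2
      + randers u h x y * (u x * (‖v‖ ^ 2 * ‖y‖⁻¹ - inner ℝ y v ^ 2 * ‖y‖⁻¹ ^ 3)) := by
  have hy' : 0 < ‖y‖ := norm_pos_iff.2 hy
  have hu : 0 < u x := lt_of_le_of_lt (by positivity) hlt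
  have hF := randers_pos hlt hy
  -- Up to the factor $|y|^2$, $w$ is the component of $v$ orthogonal to $y$. Its norm measures the
  -- Cauchy–Schwarz defect in the second summand; if $w=0$, then $v=cy$ and the form equals
  -- $c^2F^2$.
  set w := ‖y‖ ^ 2 • v - inner ℝ y v • y with hw
  have hw2 : ‖w‖ ^ 2 = ‖y‖ ^ 2 * (‖v‖ ^ 2 * ‖y‖ ^ 2 - inner ℝ y v ^ 2) := by
    rw [hw, norm_sub_sq_real, norm_smul, norm_smul, inner_smul_left, inner_smul_right,
      real_inner_comm y v]
    simp only [Real.norm_eq_abs, mul_pow, sq_abs, conj_trivial]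
    ring
  have e : ‖v‖ ^ 2 * ‖y‖⁻¹ - inner ℝ y v ^ 2 * ‖y‖⁻¹ ^ 3 = ‖w‖ ^ 2 * ‖y‖⁻¹ ^ 5 := by
    rw [hw2]
    field_simp
  rw [e]
  by_cases h0 : w = 0
  · have hc : v = (inner ℝ y v * ‖y‖⁻¹ ^ 2) • y := by
      have h1 : ‖y‖ ^ 2 • v = inner ℝ y v • y := sub_eq_zero.1 (hw.symm.trans h0)
      rw [mul_comm, mul_smul, ← h1, smul_smul, inv_pow, inv_mul_cancel₀ (by positivity), one_smul]
    set c := inner ℝ y v * ‖y‖⁻¹ ^ 2 with hcdef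
    have hc0 : c ≠ 0 := fun hc0 => hv (by rw [hc, hc0, zero_smul])
    have e1 : u x * (inner ℝ y v * ‖y‖⁻¹) + h x * inner ℝ x v = c * randers u h x y := by
      have e2 : inner ℝ x v = c * inner ℝ x y := by
        conv_lhs => rw [hc, inner_smul_right]
      rw [e2, hcdef, randers]
      field_simp
    rw [e1, h0, norm_zero]
    have : 0 < (c * randers u h x y) ^ 2 := by positivity
    simpa using this
  · have : 0 < ‖w‖ := norm_pos_iff.2 h0
    positivity

theorem SlitSmooth.norm_inv : SlitSmooth U fun _ y => ‖y‖⁻¹ :=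
  SlitSmooth.norm.inv fun _ _ _ h => norm_ne_zero_iff.2 h

theorem SlitSmooth.randers (hu : ContDiffOn ℝ ∞ u U) (hh : ContDiffOn ℝ ∞ h U) :
    SlitSmooth U (randers u h) :=
  ((SlitSmooth.base hu).mul SlitSmooth.norm).add ((SlitSmooth.base hh).mul SlitSmooth.inner)

theorem dY_randers (hU : IsOpen U) (hu : ContDiffOn ℝ ∞ u U) (hh : ContDiffOn ℝ ∞ h U)
    (k : Fin n) :
    SlitEq U (dY k (randers u h)) fun x y => u x * (y k * ‖y‖⁻¹) + h x * x k := by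
  intro x hx y hy
  unfold randers
  rw [dY_add hU ((SlitSmooth.base hu).mul SlitSmooth.norm)
    ((SlitSmooth.base hh).mul SlitSmooth.inner) hx hy, dY_base_mul hU u SlitSmooth.norm hx hy,
    dY_base_mul hU h SlitSmooth.inner hx hy, dY_norm k x hy, dY_inner]

theorem dY_dY_randers (hU : IsOpen U) (hu : ContDiffOn ℝ ∞ u U) (hh : ContDiffOn ℝ ∞ h U)
    (k l : Fin n) :
    SlitEq U (dY k (dY l (randers u h))) fun x y =>
      u x * (kron l k * ‖y‖⁻¹ - y k * y l * ‖y‖⁻¹ ^ 3) := by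
  intro x hx y hy
  have h1 : SlitSmooth U fun (_ : E n) y => y l * ‖y‖⁻¹ :=
    (SlitSmooth.fiber_coord l).mul SlitSmooth.norm_inv
  rw [(dY_randers hU hu hh l).dY_eq k x hx y hy,
    dY_add hU ((SlitSmooth.base hu).mul h1)
      ((SlitSmooth.base hh).mul (SlitSmooth.base_coord l)) hx hy,
    dY_base_mul hU u h1 hx hy, dY_base (fun x => h x * x l),
    dY_mul hU (SlitSmooth.fiber_coord l) SlitSmooth.norm_inv hx hy, dY_norm_inv k x hy, dY_coord]
  ring

theorem dY_randers_sq (hU : IsOpen U) (hu : ContDiffOn ℝ ∞ u U) (hh : ContDiffOn ℝ ∞ h U)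
    (k : Fin n) :
    SlitEq U (dY k fun x y => randers u h x y ^ 2)
      fun x y => 2 * (randers u h x y * dY k (randers u h) x y) := by
  intro x hx y hy
  have hF := SlitSmooth.randers hu hh
  simp only [sq]
  rw [dY_mul hU hF hF hx hy]
  ring

theorem dX_randers_sq (hU : IsOpen U) (hu : ContDiffOn ℝ ∞ u U) (hh : ContDiffOn ℝ ∞ h U)
    (k : Fin n) :
    SlitEq U (dX k fun x y => randers u h x y ^ 2)
      fun x y => 2 * (randers u h x y * dX k (randers u h) x y) := by
  intro x hx y hy
  have hF := SlitSmooth.randers hu hh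
  simp only [sq]
  rw [dX_mul hU hF hF hx hy]
  ring

theorem dY_dY_randers_sq (hU : IsOpen U) (hu : ContDiffOn ℝ ∞ u U) (hh : ContDiffOn ℝ ∞ h U)
    (k l : Fin n) :
    SlitEq U (dY k (dY l fun x y => randers u h x y ^ 2)) fun x y =>
      2 * ((u x * (y k * ‖y‖⁻¹) + h x * x k) * (u x * (y l * ‖y‖⁻¹) + h x * x l)
        + randers u h x y * (u x * (kron l k * ‖y‖⁻¹ - y k * y l * ‖y‖⁻¹ ^ 3))) := by
  intro x hx y hy
  have hF := SlitSmooth.randers hu hh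
  rw [(dY_randers_sq hU hu hh l).dY_eq k x hx y hy, dY_const_mul hU 2 (hF.mul (hF.dY hU l)) hx hy,
    dY_mul hU hF (hF.dY hU l) hx hy, dY_dY_randers hU hu hh k l x hx y hy,
    dY_randers hU hu hh k x hx y hy, dY_randers hU hu hh l x hx y hy]
  ring

/-- This is $g_{ij} = F_{.i}F_{.j} + F F_{.i.j}$ with the derivatives of $F$ inserted. -/
theorem fundTensor_randers (hU : IsOpen U) (hu : ContDiffOn ℝ ∞ u U) (hh : ContDiffOn ℝ ∞ h U)
    (i j : Fin n) (hx : x ∈ U) (hy : y ≠ 0) :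
    fundTensor (randers u h) x y i j =
      (u x * (y i * ‖y‖⁻¹) + h x * x i) * (u x * (y j * ‖y‖⁻¹) + h x * x j)
        + randers u h x y * (u x * (kron j i * ‖y‖⁻¹ - y i * y j * ‖y‖⁻¹ ^ 3)) := by
  rw [fundTensor, Matrix.of_apply, dY_dY_randers_sq hU hu hh i j x hx y hy]
  ring

theorem sum_fundTensor_randers (hU : IsOpen U) (hu : ContDiffOn ℝ ∞ u U) (hh : ContDiffOn ℝ ∞ h U)
    (i : Fin n) (hx : x ∈ U) (hy : y ≠ 0) (v : E n) :
    ∑ j, fundTensor (randers u h) x y i j * v j =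
      (u x * (y i * ‖y‖⁻¹) + h x * x i) * (u x * (inner ℝ y v * ‖y‖⁻¹) + h x * inner ℝ x v)
        + randers u h x y * (u x * (v i * ‖y‖⁻¹ - y i * inner ℝ y v * ‖y‖⁻¹ ^ 3)) := by
  have h1 : ∀ j, fundTensor (randers u h) x y i j * v j =
      (u x * (y i * ‖y‖⁻¹) + h x * x i) * u x * ‖y‖⁻¹ * (y j * v j)
        + (u x * (y i * ‖y‖⁻¹) + h x * x i) * h x * (x j * v j)
        + (randers u h x y * u x * ‖y‖⁻¹ * (v j * kron j i)
        - randers u h x y * u x * y i * ‖y‖⁻¹ ^ 3 * (y j * v j)) := fun j => by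
    rw [fundTensor_randers hU hu hh i j hx hy]
    ring
  simp only [h1, Finset.sum_add_distrib, Finset.sum_sub_distrib, ← Finset.mul_sum,
    ← inner_eq_sum, sum_mul_kron]
  ring

theorem sum_sum_fundTensor_randers (hU : IsOpen U) (hu : ContDiffOn ℝ ∞ u U) (hh : ContDiffOn ℝ ∞ h U)
    (hx : x ∈ U) (hy : y ≠ 0) (v : E n) :
    ∑ i, v i * ∑ j, fundTensor (randers u h) x y i j * v j =
      (u x * (inner ℝ y v * ‖y‖⁻¹) + h x * inner ℝ x v) ^ 2
      + randers u h x y * (u x * (‖v‖ ^ 2 * ‖y‖⁻¹ - inner ℝ y v ^ 2 * ‖y‖⁻¹ ^ 3)) := by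
  set A := u x * (inner ℝ y v * ‖y‖⁻¹) + h x * inner ℝ x v with hA
  have h1 : ∀ i, v i * ∑ j, fundTensor (randers u h) x y i j * v j =
      A * u x * ‖y‖⁻¹ * (y i * v i) + A * h x * (x i * v i)
        + (randers u h x y * u x * ‖y‖⁻¹ * (v i * v i)
        - randers u h x y * u x * inner ℝ y v * ‖y‖⁻¹ ^ 3 * (y i * v i)) := fun i => by
    rw [sum_fundTensor_randers hU hu hh i hx hy v, ← hA]
    ring
  simp only [h1, Finset.sum_add_distrib, Finset.sum_sub_distrib, ← Finset.mul_sum,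
    ← inner_eq_sum, real_inner_self_eq_norm_sq]
  rw [hA]
  ring

theorem randers_posDef (hU : IsOpen U) (hu : ContDiffOn ℝ ∞ u U) (hh : ContDiffOn ℝ ∞ h U)
    (hlt : |h x| * ‖x‖ < u x) (hx : x ∈ U) (hy : y ≠ 0) (hv : v ≠ 0) :
    0 < ∑ i, v i * ∑ j, fundTensor (randers u h) x y i j * v j := by
  rw [sum_sum_fundTensor_randers hU hu hh hx hy]
  exact randers_form_pos hlt hy hv

theorem randers_deriv_deriv_pos (hU : IsOpen U) (hu : ContDiffOn ℝ ∞ u U) (hh : ContDiffOn ℝ ∞ h U)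
    (hlt : |h x| * ‖x‖ < u x) (hx : x ∈ U) (hy : y ≠ 0)
    (hv : v ≠ 0) : 0 < (1 / 2 : ℝ) *
      deriv (fun s : ℝ => deriv (fun t : ℝ => randers u h x (y + s • v + t • v) ^ 2) 0) 0 := by
  have h1 := randers_posDef hU hu hh hlt hx hy hv
  have h2 := ((SlitSmooth.randers hu hh).pow 2).deriv_deriv_line hU v hx hy
  rw [h2]
  simp only [fundTensor, Matrix.of_apply, mul_assoc, ← Finset.mul_sum] at h1
  rw [Finset.mul_sum]
  refine h1.trans_eq (Finset.sum_congr rfl fun i _ => by ring)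

/-- A kernel vector would contradict positive definiteness. -/
theorem isUnit_det_fundTensor_randers (hU : IsOpen U) (hu : ContDiffOn ℝ ∞ u U) (hh : ContDiffOn ℝ ∞ h U)
    (hlt : |h x| * ‖x‖ < u x) (hx : x ∈ U) (hy : y ≠ 0) :
    IsUnit (fundTensor (randers u h) x y).det := by
  rw [isUnit_iff_ne_zero]
  intro h0
  obtain ⟨v, hv, hv0⟩ := Matrix.exists_mulVec_eq_zero_iff.2 h0
  have h1 := randers_posDef (v := WithLp.toLp 2 v) hU hu hh hlt hx hy
    (fun h => hv (by simpa using h))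
  refine h1.ne' (Finset.sum_eq_zero fun i _ => mul_eq_zero_of_right _ ?_)
  exact congrFun hv0 i

/-! ### The spray of a radial Randers metric. -/

section Spray

variable {q h₁ : E n → ℝ}

/-- The projective factor `P` with `Gⁱ = q |y|² xⁱ + P yⁱ`. -/
def randersFactor (u h q h₁ : E n → ℝ) : E n → E n → ℝ := fun x y =>
  (h₁ x * inner ℝ x y ^ 2 + h x * ‖y‖ ^ 2 - 4 * q x * u x * (inner ℝ x y * ‖y‖)
    - 2 * q x * h x * ‖x‖ ^ 2 * ‖y‖ ^ 2) * (2 * randers u h x y)⁻¹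

theorem SlitHomog.randersFactor (hlt : ∀ x ∈ U, |h x| * ‖x‖ < u x) :
    SlitHomog U 1 (randersFactor u h q h₁) := by
  intro x hx y hy c hc
  have hF := (randers_pos (hlt x hx) hy).ne'
  simp only [FinslerGeom.randersFactor, randers_smul hc, norm_smul, inner_smul_right,
    Real.norm_eq_abs, abs_of_pos hc, zpow_one]
  field_simp

theorem SlitSmooth.randersFactor (hu : ContDiffOn ℝ ∞ u U) (hh : ContDiffOn ℝ ∞ h U)
    (hq : ContDiffOn ℝ ∞ q U) (hh₁ : ContDiffOn ℝ ∞ h₁ U)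
    (hlt : ∀ x ∈ U, |h x| * ‖x‖ < u x) : SlitSmooth U (randersFactor u h q h₁) := by
  have hns : SlitSmooth U fun x _ => ‖x‖ ^ 2 := SlitSmooth.base (contDiff_norm_sq ℝ).contDiffOn
  have bq := SlitSmooth.base hq
  have bh := SlitSmooth.base hh
  have two : SlitSmooth U fun (_ : E n) (_ : E n) => (2 : ℝ) := SlitSmooth.const 2
  exact SlitSmooth.mul ((((((SlitSmooth.base hh₁).mul (SlitSmooth.inner.pow 2)).add
    (bh.mul SlitSmooth.norm_sq)).sub ((((SlitSmooth.const 4).mul bq).mul (SlitSmooth.base hu)).mul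
    (SlitSmooth.inner.mul SlitSmooth.norm)))).sub
    ((((two.mul bq).mul bh).mul hns).mul SlitSmooth.norm_sq))
    ((two.mul (SlitSmooth.randers hu hh)).inv fun x hx y hy =>
      mul_ne_zero two_ne_zero (randers_pos (hlt x hx) hy).ne')

/-- A Randers metric `u |y| + h ⟨x, y⟩` with `u`, `h` radial is projectively equivalent to the
quadratic spray `q |y|² xⁱ`, where `du = -2 q u ⟨x, dx⟩`. -/
theorem sprayCoeff_randers (hU : IsOpen U) (hu : ContDiffOn ℝ ∞ u U) (hh : ContDiffOn ℝ ∞ h U)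
    (hlt : ∀ x ∈ U, |h x| * ‖x‖ < u x)
    (hu₁ : ∀ x ∈ U, ∀ k, fderiv ℝ u x (stdVec k) = -2 * q x * u x * x k)
    (hh₁ : ∀ x ∈ U, ∀ k, fderiv ℝ h x (stdVec k) = h₁ x * x k) (i : Fin n) :
    SlitEq U (sprayCoeff (randers u h) i)
      (projChange (radialSpray q) (randersFactor u h q h₁) i) := by
  intro x hx y hy
  have hF := SlitSmooth.randers hu hh
  have bu := SlitSmooth.base hu
  have bh := SlitSmooth.base hh
  have hy' : ‖y‖ ≠ 0 := norm_ne_zero_iff.2 hy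
  have hF0 := (randers_pos (hlt x hx) hy).ne'
  have du : ∀ k, dX k (fun x _ => u x) x y = -2 * q x * u x * x k := hu₁ x hx
  have dh : ∀ k, dX k (fun x _ => h x) x y = h₁ x * x k := hh₁ x hx
  have dF : ∀ k, dX k (randers u h) x y = -2 * q x * u x * x k * ‖y‖
      + (h x * y k + h₁ x * x k * inner ℝ x y) := fun k => by
    unfold randers
    rw [dX_add hU (bu.mul SlitSmooth.norm) (bh.mul SlitSmooth.inner) hx hy,
      dX_mul_fiber hU bu (fun y => ‖y‖) hx hy, dX_mul hU bh SlitSmooth.inner hx hy, du, dh,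
      dX_inner]
  have dFl : ∀ k l, dX k (dY l (randers u h)) x y = -2 * q x * u x * x k * (y l * ‖y‖⁻¹)
      + (h x * kron l k + h₁ x * x k * x l) := fun k l => by
    have h1 : SlitSmooth U fun (_ : E n) y => y l * ‖y‖⁻¹ :=
      (SlitSmooth.fiber_coord l).mul SlitSmooth.norm_inv
    rw [(dY_randers hU hu hh l).dX_eq hU k x hx y hy,
      dX_add hU (bu.mul h1) (bh.mul (SlitSmooth.base_coord l)) hx hy,
      dX_mul_fiber hU bu (fun y => y l * ‖y‖⁻¹) hx hy, dX_mul hU bh (SlitSmooth.base_coord l) hx hy,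
      du, dh, dX_coord]
  -- $F_0 = F_{x^k}y^k$. In `hvec` the derivatives of $h$ occur only through $F_0$: this is
  -- closedness of $h\langle x,dx\rangle$.
  set F₀ := -2 * q x * u x * inner ℝ x y * ‖y‖ + h x * ‖y‖ ^ 2 + h₁ x * inner ℝ x y ^ 2 with hF₀
  have hvec : ∀ l, (∑ k, dX k (dY l (fun x y => randers u h x y ^ 2)) x y * y k)
      - dX l (fun x y => randers u h x y ^ 2) x y
      = 2 * F₀ * (u x * (y l * ‖y‖⁻¹) + h x * x l)
        + 4 * q x * u x * randers u h x y * (x l * ‖y‖ - inner ℝ x y * y l * ‖y‖⁻¹) := fun l => by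
    have h1 : ∀ k, dX k (dY l (fun x y => randers u h x y ^ 2)) x y * y k
        = (-4 * q x * u x * ‖y‖ * (u x * (y l * ‖y‖⁻¹) + h x * x l)
          + 2 * h₁ x * inner ℝ x y * (u x * (y l * ‖y‖⁻¹) + h x * x l)
          - 4 * randers u h x y * q x * u x * (y l * ‖y‖⁻¹)
          + 2 * randers u h x y * h₁ x * x l) * (x k * y k)
          + 2 * (u x * (y l * ‖y‖⁻¹) + h x * x l) * h x * (y k * y k)
          + 2 * randers u h x y * h x * (y k * kron l k) := fun k => by
      have h2 := dX_mul_fiber hU (hF.mul (hF.dY hU l)) (fun _ => (2 : ℝ)) hx hy k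
      have h3 : SlitEq U (dY l fun x y => randers u h x y ^ 2)
          fun x y => randers u h x y * dY l (randers u h) x y * 2 :=
        (dY_randers_sq hU hu hh l).trans fun _ _ _ _ => by ring
      rw [h3.dX_eq hU k x hx y hy, h2, dX_mul hU hF (hF.dY hU l) hx hy, dF, dFl,
        dY_randers hU hu hh l x hx y hy]
      ring
    rw [dX_randers_sq hU hu hh l x hx y hy]
    simp only [dF, h1, Finset.sum_add_distrib, ← Finset.mul_sum, ← inner_eq_sum,
      real_inner_self_eq_norm_sq, sum_mul_kron']
    rw [hF₀]
    ring
  set P := randersFactor u h q h₁ x y with hP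
  -- The matrix $g$ is never inverted explicitly: $w = 4(Q+Py)$ is the expected answer, and it
  -- suffices that $g\,w$ equals the covector in the spray formula.
  set w : E n := (4 * q x * ‖y‖ ^ 2) • x + (4 * P) • y with hw
  have hw_apply : ∀ l, w l = 4 * projChange (radialSpray q) (randersFactor u h q h₁) l x y :=
    fun l => by
      simp only [hw, projChange, radialSpray, PiLp.add_apply, PiLp.smul_apply, smul_eq_mul, ← hP]
      ring
  -- This is $P = (F_{x^k}y^k - 2Q^kF_{.k})/(2F)$, the projective factor of $F$ relative to the
  -- spray $Q$.
  have hPF : 2 * P * randers u h x y = F₀ - 2 * q x * u x * (inner ℝ x y * ‖y‖)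
      - 2 * q x * h x * ‖x‖ ^ 2 * ‖y‖ ^ 2 := by
    rw [hP, randersFactor, hF₀]
    field_simp
    ring
  have ipw : inner ℝ y w = 4 * q x * ‖y‖ ^ 2 * inner ℝ x y + 4 * P * ‖y‖ ^ 2 := by
    rw [hw, inner_add_right, inner_smul_right, inner_smul_right, real_inner_self_eq_norm_sq,
      real_inner_comm]
  have ixw : inner ℝ x w = 4 * q x * ‖y‖ ^ 2 * ‖x‖ ^ 2 + 4 * P * inner ℝ x y := by
    rw [hw, inner_add_right, inner_smul_right, inner_smul_right, real_inner_self_eq_norm_sq]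
  -- The left side is $F_{.l}w^l$, the scalar in the rank-one part of $g\,w$; the choice of $P$
  -- makes it match the $F_0$ term of `hvec`.
  have hA : u x * (inner ℝ y w * ‖y‖⁻¹) + h x * inner ℝ x w = 2 * F₀ := by
    have : u x * (inner ℝ y w * ‖y‖⁻¹) + h x * inner ℝ x w = 2 * (2 * P * randers u h x y)
        + 4 * q x * u x * (inner ℝ x y * ‖y‖) + 4 * q x * h x * ‖x‖ ^ 2 * ‖y‖ ^ 2 := by
      rw [ipw, ixw, randers]
      field_simp
      ring
    rw [this, hPF]
    ring
  have hmul : (fundTensor (randers u h) x y).mulVec w = fun l =>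
      (∑ k, dX k (dY l (fun x y => randers u h x y ^ 2)) x y * y k)
      - dX l (fun x y => randers u h x y ^ 2) x y := by
    funext l
    have h1 := sum_fundTensor_randers hU hu hh l hx hy w
    rw [hA] at h1
    rw [hvec]
    refine h1.trans ?_
    have h2 : w l = 4 * q x * ‖y‖ ^ 2 * x l + 4 * P * y l := by simp [hw]
    rw [ipw, h2]
    field_simp
    ring
  have hinv : ∑ l, (fundTensor (randers u h) x y)⁻¹ i l *
      ((∑ k, dX k (dY l (fun x y => randers u h x y ^ 2)) x y * y k)
      - dX l (fun x y => randers u h x y ^ 2) x y) = w i := by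
    have h1 : (fundTensor (randers u h) x y)⁻¹.mulVec
        ((fundTensor (randers u h) x y).mulVec w) = w := by
      rw [Matrix.mulVec_mulVec, Matrix.nonsing_inv_mul _
        (isUnit_det_fundTensor_randers hU hu hh (hlt x hx) hx hy), Matrix.one_mulVec]
    rw [hmul] at h1
    exact congrFun h1 i
  rw [sprayCoeff, hinv, hw_apply]
  ring

end Spray

end

/-! ### Charts and the tangent bundle of the ball. -/

section

variable {n : ℕ} {ν : ℝ}

/-- Every chart in the atlas is the identity chart of $\mathbb R^n$ restricted to the ball, so the
choice of the point `p` is immaterial. -/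
theorem chart_openBall {e : OpenPartialHomeomorph (openBall n ν) (E n)}
    (he : e ∈ atlas (E n) (openBall n ν)) (p : openBall n ν) : e = chartAt (E n) p := by
  obtain ⟨x, rfl⟩ := TopologicalSpace.Opens.chart_eq ⟨p⟩ he
  rfl

theorem chartAt_openBall_target (p : openBall n ν) :
    (chartAt (E n) p).target = Metric.ball 0 ν := by
  rw [TopologicalSpace.Opens.chartAt_eq, OpenPartialHomeomorph.subtypeRestr_def]
  rw [chartAt_self_eq, OpenPartialHomeomorph.trans_refl]
  exact TopologicalSpace.Opens.openPartialHomeomorphSubtypeCoe_target _ _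

theorem chartAt_openBall_symm (p : openBall n ν) {x : E n} (hx : x ∈ Metric.ball (0 : E n) ν) :
    (chartAt (E n) p).symm x = ⟨x, hx⟩ := by
  rw [← chartAt_openBall_target p] at hx
  exact Subtype.ext ((chartAt (E n) p).right_inv hx)

theorem mfderiv_subtype_val_openBall (p : openBall n ν) (v : TangentSpace (𝓡 n) p) :
    mfderiv (𝓡 n) (𝓡 n) (Subtype.val : openBall n ν → E n) p v = (v : E n) := by
  have hd : MDifferentiableAt (𝓡 n) (𝓡 n) (Subtype.val : openBall n ν → E n) p :=
    (contMDiff_subtype_val (n := 1)).mdifferentiableAt one_ne_zero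
  rw [hd.mfderiv]
  have h : writtenInExtChartAt (𝓡 n) (𝓡 n) p (Subtype.val : openBall n ν → E n)
      =ᶠ[𝓝 (p : E n)] id := by
    filter_upwards [Metric.isOpen_ball.mem_nhds p.2] with x hx
    have := chartAt_openBall_symm p hx
    simp only [writtenInExtChartAt, extChartAt, mfld_simps, this, Function.comp_apply]
    rfl
  have h2 : fderivWithin ℝ (writtenInExtChartAt (𝓡 n) (𝓡 n) p (Subtype.val : openBall n ν → E n))
      (Set.range (𝓡 n)) ((extChartAt (𝓡 n) p) p) = ContinuousLinearMap.id ℝ (E n) := by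
    rw [ModelWithCorners.range_eq_univ, fderivWithin_univ]
    exact h.fderiv_eq.trans fderiv_id
  rw [h2]
  rfl

/-- The inclusion composed with the inverse chart is the identity near `x`, and the inclusion has
identity differential; the chain rule gives the claim. -/
theorem chartVec_openBall (p : openBall n ν) {x : E n} (hx : x ∈ Metric.ball (0 : E n) ν) (y : E n) :
    (chartVec (chartAt (E n) p) x y : E n) = y := by
  have hx' := hx
  rw [← chartAt_openBall_target p] at hx'
  have hd : MDifferentiableAt (𝓡 n) (𝓡 n) (chartAt (E n) p).symm x :=
    mdifferentiableAt_atlas_symm (chart_mem_atlas _ p) hx'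
  have hι : MDifferentiableAt (𝓡 n) (𝓡 n) (Subtype.val : openBall n ν → E n)
      ((chartAt (E n) p).symm x) :=
    (contMDiff_subtype_val (n := 1)).mdifferentiableAt one_ne_zero
  have h1 := mfderiv_comp x hι hd
  have h2 : (Subtype.val : openBall n ν → E n) ∘ (chartAt (E n) p).symm =ᶠ[𝓝 x] id := by
    filter_upwards [Metric.isOpen_ball.mem_nhds hx] with x' hx'
    simp [chartAt_openBall_symm p hx']
  rw [h2.mfderiv_eq] at h1
  have h3 := congrArg (fun L : E n →L[ℝ] E n => L y) h1
  rw [mfderiv_id] at h3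
  exact (mfderiv_subtype_val_openBall _ _).symm.trans h3.symm

/-- The tangent map of the inclusion is smooth into the trivial bundle $T\mathbb R^n$, so base point
and fibre component are smooth functions on the tangent bundle of the ball. -/
theorem contMDiffOn_tangentBundle_openBall {f : E n → E n → ℝ}
    (hf : SlitSmooth (Metric.ball 0 ν) f) :
    ContMDiffOn (𝓡 n).tangent 𝓘(ℝ, ℝ) ∞
      (fun w : TangentBundle (𝓡 n) (openBall n ν) => f w.1 (w.2 : E n)) {w | w.2 ≠ 0} := by
  have h1 : ContMDiff (𝓡 n).tangent (𝓡 n).tangent ∞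
      (tangentMap (𝓡 n) (𝓡 n) (Subtype.val : openBall n ν → E n)) :=
    (contMDiff_subtype_val (n := ∞)).contMDiff_tangentMap (by simp)
  have h2 : ContMDiff (𝓡 n).tangent (𝓡 n) ∞ fun w : TangentBundle (𝓡 n) (openBall n ν) =>
      (w.1 : E n) :=
    (contMDiff_subtype_val (n := ∞)).comp (Bundle.contMDiff_proj _)
  have h3 : ContMDiff (𝓡 n).tangent 𝓘(ℝ, E n) ∞ fun w : TangentBundle (𝓡 n) (openBall n ν) =>
      (w.2 : E n) := by
    have := (contMDiff_snd_tangentBundle_modelSpace (E n) (𝓡 n)).comp h1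
    refine this.congr fun w => ?_
    exact (mfderiv_subtype_val_openBall w.1 w.2).symm
  have h4 := h2.prodMk_space h3
  exact (ContDiffOn.contMDiffOn hf).comp h4.contMDiffOn fun w hw => ⟨w.1.2, hw⟩

end

/-! ### Locality of the curvatures -/

section Congr

variable {n : ℕ} {U : Set (E n)} {F F' : E n → E n → ℝ} {G G' : Fin n → E n → E n → ℝ}

/-- With the congruences below, this allows chart expressions to be replaced by explicit formulas
known only off the zero section. -/
theorem SlitEq.sprayCoeff_eq (hU : IsOpen U) (h : SlitEq U F F') (i : Fin n) :
    SlitEq U (sprayCoeff F i) (sprayCoeff F' i) := by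
  have h2 : SlitEq U (fun x y => F x y ^ 2) fun x y => F' x y ^ 2 :=
    fun x hx y hy => congrArg (· ^ 2) (h x hx y hy)
  intro x hx y hy
  have hg : fundTensor F x y = fundTensor F' x y := by
    ext a b
    simp only [fundTensor, Matrix.of_apply, ((h2.dY_eq b).dY_eq a) x hx y hy]
  simp only [sprayCoeff, hg, (h2.dY_eq _).dX_eq hU _ x hx y hy, h2.dX_eq hU _ x hx y hy]

theorem SlitEq.riem_eq (hU : IsOpen U) (h : ∀ i, SlitEq U (G i) (G' i)) (i k : Fin n) :
    SlitEq U (riem G i k) (riem G' i k) := by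
  intro x hx y hy
  simp only [riem, (h _).dX_eq hU _ x hx y hy, (h _).dY_eq _ x hx y hy, (h _) x hx y hy,
    ((h _).dY_eq _).dX_eq hU _ x hx y hy, ((h _).dY_eq _).dY_eq _ x hx y hy]

theorem SlitEq.aTensor_eq (hU : IsOpen U) (h : ∀ i, SlitEq U (G i) (G' i)) (i k : Fin n) :
    SlitEq U (aTensor G i k) (aTensor G' i k) := by
  intro x hx y hy
  simp only [aTensor, ricScalar, SlitEq.riem_eq hU h _ _ x hx y hy]

theorem SlitEq.weyl_eq (hU : IsOpen U) (h : ∀ i, SlitEq U (G i) (G' i)) (i k : Fin n) :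
    SlitEq U (weyl G i k) (weyl G' i k) := by
  intro x hx y hy
  simp only [weyl, SlitEq.aTensor_eq hU h _ _ x hx y hy,
    (SlitEq.aTensor_eq hU h _ _).dY_eq _ x hx y hy]

theorem SlitEq.douglas_eq (h : ∀ i, SlitEq U (G i) (G' i)) (j i k l : Fin n) :
    SlitEq U (douglas G j i k l) (douglas G' j i k l) := by
  have h1 : SlitEq U (fun x y => (∑ m, dY m (G m) x y) * y i)
      fun x y => (∑ m, dY m (G' m) x y) * y i := fun x hx y hy => by
    simp only [(h _).dY_eq _ x hx y hy]
  intro x hx y hy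
  simp only [douglas, (((h i).dY_eq l).dY_eq k).dY_eq j x hx y hy,
    ((h1.dY_eq l).dY_eq k).dY_eq j x hx y hy]

theorem covH0_eq_zero {T : Fin n → Fin n → Fin n → Fin n → E n → E n → ℝ} (hU : IsOpen U)
    (h : ∀ j i k l, SlitEq U (T j i k l) fun _ _ => 0) (j i k l : Fin n) :
    SlitEq U (covH0 G T j i k l) fun _ _ => 0 := by
  intro x hx y hy
  simp [covH0, covH, dH, (h _ _ _ _).dX_eq hU _ x hx y hy, (h _ _ _ _).dY_eq _ x hx y hy,
    (h _ _ _ _) x hx y hy]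

end Congr

/-! ### From Weyl to weakly-Weyl to generalized weakly-Weyl. -/

namespace FinslerMetric

variable {n : ℕ} {M : Type*} [TopologicalSpace M] [ChartedSpace (E n) M]
  [IsManifold (𝓡 n) ∞ M] {F : FinslerMetric n M}

theorem IsWeaklyWeyl.isGenWeaklyWeyl (h : F.IsWeaklyWeyl) : F.IsGenWeaklyWeyl := by
  refine ⟨fun _ _ => 0, fun _ _ => 0, contMDiffOn_const, fun e _ r => contDiffOn_const,
    fun e he x hx y hy j i k l => ?_⟩
  have hz : ∀ j i k l, SlitEq e.target (weakWeyl (F.spray e) j i k l) fun _ _ => 0 :=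
    fun j i k l x hx y hy => h e he x hx y hy j i k l
  rw [covH0_eq_zero e.open_target hz j i k l x hx y hy]
  simp [hz _ _ _ _ x hx y hy]

theorem IsWeyl.isWeaklyWeyl (h : F.IsWeyl) : F.IsWeaklyWeyl := by
  intro e he x hx y hy j i k l
  refine weakWeyl_eq_zero_of_fiberQuadratic (U := e.target) (fun i k => ?_) j i k l x hx y hy
  -- Zero is a quadratic form, so the criterion for quadratic Weyl curvature applies.
  exact ⟨fun _ _ _ => 0, fun x hx y hy => by simpa using h e he x hx y hy i k⟩

end FinslerMetric

/-! ### The Randers metrics of the theorem -/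

section Example

variable {n : ℕ} {ν a b lam : ℝ}

/-- The function `a + b |x|²`. -/
def wgt (n : ℕ) (a b : ℝ) (x : E n) : ℝ := a + b * ‖x‖ ^ 2

/-- The coefficient `u = (a + b |x|²)^(-lam)`. -/
def coeffU (n : ℕ) (a b lam : ℝ) (x : E n) : ℝ := wgt n a b x ^ (-lam)

/-- The coefficient `h = u / (1 + |x|²)`. -/
def coeffH (n : ℕ) (a b lam : ℝ) (x : E n) : ℝ := coeffU n a b lam x * (1 + ‖x‖ ^ 2)⁻¹

/-- The coefficient `q = lam b / (a + b |x|²)` of the spray. -/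
def coeffQ (n : ℕ) (a b lam : ℝ) (x : E n) : ℝ := lam * b * (wgt n a b x)⁻¹

/-- `dq = q₁ ⟨x, dx⟩`. -/
def coeffQ' (n : ℕ) (a b lam : ℝ) (x : E n) : ℝ := -2 * lam * b ^ 2 * (wgt n a b x)⁻¹ ^ 2

/-- `dh = h₁ ⟨x, dx⟩`. -/
def coeffH' (n : ℕ) (a b lam : ℝ) (x : E n) : ℝ :=
  -2 * coeffQ n a b lam x * coeffH n a b lam x
    - 2 * coeffU n a b lam x * (1 + ‖x‖ ^ 2)⁻¹ ^ 2

theorem wgt_pos (hab : ∀ r ∈ Set.Ico 0 ν, 0 < a + b * r ^ 2) {x : E n}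
    (hx : x ∈ Metric.ball (0 : E n) ν) : 0 < wgt n a b x :=
  hab ‖x‖ ⟨norm_nonneg x, by simpa using hx⟩

theorem contDiff_wgt : ContDiff ℝ ∞ (wgt n a b) :=
  contDiff_const.add (contDiff_const.mul (contDiff_norm_sq ℝ))

theorem hasFDerivAt_norm_sq_base (x : E n) :
    HasFDerivAt (fun x : E n => ‖x‖ ^ 2) (2 • innerSL ℝ x) x :=
  (hasStrictFDerivAt_norm_sq x).hasFDerivAt

theorem innerSL_stdVec (x : E n) (k : Fin n) : innerSL ℝ x (stdVec k) = x k := by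
  simp [stdVec, EuclideanSpace.inner_single_right]

theorem hasFDerivAt_wgt (x : E n) :
    HasFDerivAt (wgt n a b) (b • (2 • innerSL ℝ x)) x :=
  ((hasFDerivAt_norm_sq_base x).const_mul b).const_add a

theorem contDiffOn_coeffU (hab : ∀ r ∈ Set.Ico 0 ν, 0 < a + b * r ^ 2) :
    ContDiffOn ℝ ∞ (coeffU n a b lam) (Metric.ball 0 ν) :=
  contDiff_wgt.contDiffOn.rpow_const_of_ne fun _ hx => (wgt_pos hab hx).ne'

theorem contDiff_inv_one_add : ContDiff ℝ ∞ fun x : E n => (1 + ‖x‖ ^ 2)⁻¹ :=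
  (contDiff_const.add (contDiff_norm_sq ℝ)).inv fun x => by positivity

theorem contDiffOn_coeffH (hab : ∀ r ∈ Set.Ico 0 ν, 0 < a + b * r ^ 2) :
    ContDiffOn ℝ ∞ (coeffH n a b lam) (Metric.ball 0 ν) :=
  (contDiffOn_coeffU hab).mul contDiff_inv_one_add.contDiffOn

theorem contDiffOn_inv_wgt (hab : ∀ r ∈ Set.Ico 0 ν, 0 < a + b * r ^ 2) :
    ContDiffOn ℝ ∞ (fun x => (wgt n a b x)⁻¹) (Metric.ball 0 ν) :=
  contDiff_wgt.contDiffOn.inv fun _ hx => (wgt_pos hab hx).ne'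

theorem contDiffOn_coeffQ (hab : ∀ r ∈ Set.Ico 0 ν, 0 < a + b * r ^ 2) :
    ContDiffOn ℝ ∞ (coeffQ n a b lam) (Metric.ball 0 ν) :=
  contDiffOn_const.mul (contDiffOn_inv_wgt hab)

theorem contDiffOn_coeffQ' (hab : ∀ r ∈ Set.Ico 0 ν, 0 < a + b * r ^ 2) :
    ContDiffOn ℝ ∞ (coeffQ' n a b lam) (Metric.ball 0 ν) :=
  contDiffOn_const.mul ((contDiffOn_inv_wgt hab).pow 2)

theorem contDiffOn_coeffH' (hab : ∀ r ∈ Set.Ico 0 ν, 0 < a + b * r ^ 2) :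
    ContDiffOn ℝ ∞ (coeffH' n a b lam) (Metric.ball 0 ν) :=
  ((contDiffOn_const.mul (contDiffOn_coeffQ hab)).mul (contDiffOn_coeffH hab)).sub
    ((contDiffOn_const.mul (contDiffOn_coeffU hab)).mul (contDiff_inv_one_add.pow 2).contDiffOn)

theorem hasFDerivAt_coeffU {x : E n} (hw : 0 < wgt n a b x) :
    HasFDerivAt (coeffU n a b lam)
      ((-2 * coeffQ n a b lam x * coeffU n a b lam x) • innerSL ℝ x) x := by
  have h := (hasFDerivAt_wgt x).rpow_const (p := -lam) (Or.inl hw.ne')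
  convert! h using 1
  rw [Real.rpow_sub_one hw.ne']
  ext v
  simp only [coeffQ, coeffU, smul_apply, smul_eq_mul, two_smul, add_apply]
  field_simp
  ring

theorem fderiv_coeffU {x : E n} (hw : 0 < wgt n a b x) (k : Fin n) :
    fderiv ℝ (coeffU n a b lam) x (stdVec k)
      = -2 * coeffQ n a b lam x * coeffU n a b lam x * x k := by
  rw [(hasFDerivAt_coeffU hw).fderiv, smul_apply, innerSL_stdVec]
  rfl

theorem fderiv_coeffH {x : E n} (hw : 0 < wgt n a b x) (k : Fin n) :
    fderiv ℝ (coeffH n a b lam) x (stdVec k) = coeffH' n a b lam x * x k := by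
  have h0 : 1 + ‖x‖ ^ 2 ≠ 0 := by positivity
  have h1 := ((hasDerivAt_inv h0).comp_hasFDerivAt x ((hasFDerivAt_norm_sq_base x).const_add 1))
  have h2 := (hasFDerivAt_coeffU (lam := lam) hw).mul h1
  have h3 : HasFDerivAt (coeffH n a b lam) _ x := h2
  rw [h3.fderiv]
  simp only [add_apply, smul_apply, innerSL_stdVec, smul_eq_mul, two_smul, coeffH',
    coeffH, Function.comp_apply]
  field_simp
  ring

theorem fderiv_coeffQ {x : E n} (hw : 0 < wgt n a b x) (k : Fin n) :
    fderiv ℝ (coeffQ n a b lam) x (stdVec k) = coeffQ' n a b lam x * x k := by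
  have h2 := (((hasDerivAt_inv hw.ne').comp_hasFDerivAt x (hasFDerivAt_wgt x))).const_mul (lam * b)
  have h3 : HasFDerivAt (coeffQ n a b lam) _ x := h2
  rw [h3.fderiv]
  simp only [add_apply, smul_apply, innerSL_stdVec, smul_eq_mul, two_smul, coeffQ']
  field_simp
  ring

/-- The factor $(1+|x|^2)^{-1}$ in $h$ is chosen for this: $|x| < 1+|x|^2$ everywhere, so the
Randers condition holds on a ball of any radius. -/
theorem coeffH_lt {x : E n} (hw : 0 < wgt n a b x) :
    |coeffH n a b lam x| * ‖x‖ < coeffU n a b lam x := by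
  have hu : 0 < coeffU n a b lam x := Real.rpow_pos_of_pos hw _
  have h0 : (0 : ℝ) < 1 + ‖x‖ ^ 2 := by positivity
  have h1 : ‖x‖ < 1 + ‖x‖ ^ 2 := by nlinarith [sq_nonneg (‖x‖ - 1), norm_nonneg x]
  rw [coeffH, abs_of_pos (by positivity), mul_assoc]
  refine mul_lt_of_lt_one_right hu ?_
  rw [inv_mul_lt_iff₀ h0, mul_one]
  exact h1

/-- The Randers metric `u |y| + h ⟨x, y⟩` on the ball. -/
def randersBall (n : ℕ) (ν a b lam : ℝ) (hab : ∀ r ∈ Set.Ico 0 ν, 0 < a + b * r ^ 2) :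
    FinslerMetric n (openBall n ν) where
  toFun p v := randers (coeffU n a b lam) (coeffH n a b lam) (p : E n) (v : E n)
  nonneg p v := by
    by_cases hv : (v : E n) = 0
    · have h0 : randers (coeffU n a b lam) (coeffH n a b lam) (p : E n) (0 : E n) = 0 := by
        simp [randers]
      exact (h0.symm.trans (congrArg _ hv.symm)).le
    · exact (randers_pos (coeffH_lt (wgt_pos hab p.2)) hv).le
  smooth := contMDiffOn_tangentBundle_openBall
    (SlitSmooth.randers (contDiffOn_coeffU hab) (contDiffOn_coeffH hab))
  homog _ hc _ _ := randers_smul hc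
  posDef p v u hv hu := randers_deriv_deriv_pos Metric.isOpen_ball (contDiffOn_coeffU hab)
    (contDiffOn_coeffH hab) (coeffH_lt (wgt_pos hab p.2)) p.2 hv hu

theorem inChart_randersBall (hab : ∀ r ∈ Set.Ico 0 ν, 0 < a + b * r ^ 2)
    (p : openBall n ν) :
    SlitEq (Metric.ball 0 ν) (inChart (chartAt (E n) p) (randersBall n ν a b lam hab).toFun)
      (randers (coeffU n a b lam) (coeffH n a b lam)) := by
  intro x hx y _
  have h1 : (((chartAt (E n) p).symm x : openBall n ν) : E n) = x :=
    congrArg Subtype.val (chartAt_openBall_symm p hx)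
  have h2 := chartVec_openBall p hx y
  change randers _ _ (((chartAt (E n) p).symm x : openBall n ν) : E n)
    (chartVec (chartAt (E n) p) x y : E n) = _
  rw [h1, h2]

theorem spray_randersBall (hab : ∀ r ∈ Set.Ico 0 ν, 0 < a + b * r ^ 2)
    (p : openBall n ν) (i : Fin n) :
    SlitEq (Metric.ball 0 ν) ((randersBall n ν a b lam hab).spray (chartAt (E n) p) i)
      (projChange (radialSpray (coeffQ n a b lam)) (randersFactor (coeffU n a b lam)
        (coeffH n a b lam) (coeffQ n a b lam) (coeffH' n a b lam)) i) :=
  ((inChart_randersBall hab p).sprayCoeff_eq Metric.isOpen_ball i).trans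
    (sprayCoeff_randers Metric.isOpen_ball (contDiffOn_coeffU hab) (contDiffOn_coeffH hab)
      (fun _ hx => coeffH_lt (wgt_pos hab hx)) (fun _ hx => fderiv_coeffU (wgt_pos hab hx))
      (fun _ hx => fderiv_coeffH (wgt_pos hab hx)) i)

theorem smooth_randersFactor (hab : ∀ r ∈ Set.Ico 0 ν, 0 < a + b * r ^ 2) : SlitSmooth (Metric.ball (0 : E n) ν) (randersFactor
    (coeffU n a b lam) (coeffH n a b lam) (coeffQ n a b lam) (coeffH' n a b lam)) :=
  SlitSmooth.randersFactor (contDiffOn_coeffU hab) (contDiffOn_coeffH hab)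
    (contDiffOn_coeffQ hab) (contDiffOn_coeffH' hab) fun _ hx => coeffH_lt (wgt_pos hab hx)

theorem homog_randersFactor (hab : ∀ r ∈ Set.Ico 0 ν, 0 < a + b * r ^ 2) : SlitHomog (Metric.ball (0 : E n) ν) 1 (randersFactor
    (coeffU n a b lam) (coeffH n a b lam) (coeffQ n a b lam) (coeffH' n a b lam)) :=
  SlitHomog.randersFactor fun _ hx => coeffH_lt (wgt_pos hab hx)

theorem weyl_randersBall (hab : ∀ r ∈ Set.Ico 0 ν, 0 < a + b * r ^ 2)
    (hn : 2 ≤ n) (p : openBall n ν) (i k : Fin n) :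
    SlitEq (Metric.ball 0 ν) (weyl ((randersBall n ν a b lam hab).spray (chartAt (E n) p)) i k)
      (weyl (radialSpray (coeffQ n a b lam)) i k) :=
  (SlitEq.weyl_eq Metric.isOpen_ball (spray_randersBall hab p) i k).trans
    (weyl_projChange hn Metric.isOpen_ball (SlitSmooth.radialSpray (contDiffOn_coeffQ hab))
      (smooth_randersFactor hab) SlitHomog.radialSpray (homog_randersFactor hab) i k)

theorem randersBall_isDouglas (hab : ∀ r ∈ Set.Ico 0 ν, 0 < a + b * r ^ 2) : (randersBall n ν a b lam hab).IsDouglas := by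
  intro e he x hx y hy j i k l
  -- Any point of the ball would do; `e.symm x` is simply one at hand.
  rw [chart_openBall he (e.symm x)] at hx ⊢
  rw [chartAt_openBall_target] at hx
  rw [SlitEq.douglas_eq (spray_randersBall hab _) j i k l x hx y hy]
  exact douglas_projChange Metric.isOpen_ball (SlitSmooth.radialSpray (contDiffOn_coeffQ hab))
    (smooth_randersFactor hab) (homog_randersFactor hab) FiberQuadratic.radialSpray
    (FiberQuadratic.div_radialSpray_mul Metric.isOpen_ball) j i k l x hx y hy

theorem randersBall_isWeaklyWeyl (hab : ∀ r ∈ Set.Ico 0 ν, 0 < a + b * r ^ 2)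
    (hn : 2 ≤ n) : (randersBall n ν a b lam hab).IsWeaklyWeyl := by
  intro e he x hx y hy j i k l
  rw [chart_openBall he (e.symm x)] at hx ⊢
  rw [chartAt_openBall_target] at hx
  refine weakWeyl_eq_zero_of_fiberQuadratic (fun i k => ?_) j i k l x hx y hy
  exact (FiberQuadratic.weyl_radialSpray hn Metric.isOpen_ball (contDiffOn_coeffQ hab)
    (contDiffOn_coeffQ' hab) (fun _ hx => fderiv_coeffQ (wgt_pos hab hx)) i k).congr
    (weyl_randersBall hab hn _ i k)

/-- Take $x$ along the first axis, $y$ along the second, and the component with both indices in the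
third direction, which is where $n\ge3$ enters. Every term except the one with
$|x|^2\delta^i_k|y|^2$ vanishes, leaving $-(2q_1+4q^2)|x|^2/(n-1)$. -/
theorem not_isWeyl_randersBall (hab : ∀ r ∈ Set.Ico 0 ν, 0 < a + b * r ^ 2)
    (hn : 3 ≤ n) (hν : 0 < ν) (hb : b ≠ 0) (h0 : lam ≠ 0)
    (h1 : lam ≠ 1) : ¬ (randersBall n ν a b lam hab).IsWeyl := by
  intro hW
  let p : openBall n ν := ⟨0, Metric.mem_ball_self hν⟩
  let i₀ : Fin n := ⟨0, by omega⟩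
  let i₁ : Fin n := ⟨1, by omega⟩
  let i₂ : Fin n := ⟨2, by omega⟩
  have h01 : i₁ ≠ i₀ := by simp [i₀, i₁]
  have h02 : i₂ ≠ i₀ := by simp [i₀, i₂]
  have h12 : i₂ ≠ i₁ := by simp [i₁, i₂]
  let x : E n := (ν / 2) • stdVec i₀
  let y : E n := stdVec i₁
  have nstd : ∀ i : Fin n, ‖(stdVec i : E n)‖ = 1 := fun i => by simp [stdVec]
  have nx : ‖x‖ = ν / 2 := by
    rw [norm_smul, nstd, mul_one, Real.norm_eq_abs, abs_of_pos (by positivity)]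
  have hx : x ∈ Metric.ball (0 : E n) ν := by
    rw [mem_ball_zero_iff, nx]
    linarith
  have hy : y ≠ 0 := norm_ne_zero_iff.1 (by rw [nstd]; exact one_ne_zero)
  have hxy : inner ℝ x y = (0 : ℝ) := by
    simp [x, y, stdVec, inner_smul_left, EuclideanSpace.inner_single_right, h01]
  have y2 : y i₂ = 0 := (stdVec_apply _ _).trans (if_neg h12)
  have x2 : x i₂ = 0 := by
    simp [x, stdVec_apply, kron, h02]
  have hw := wgt_pos hab hx
  have hn2 : 2 ≤ n := by omega
  have e := hW (chartAt (E n) p) (chart_mem_atlas _ p) x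
    (by rw [chartAt_openBall_target]; exact hx) y hy i₂ i₂
  rw [weyl_randersBall hab hn2 p i₂ i₂ x hx y hy,
    weyl_radialSpray hn2 Metric.isOpen_ball (contDiffOn_coeffQ hab) (contDiffOn_coeffQ' hab)
      (fun _ hx => fderiv_coeffQ (wgt_pos hab hx)) i₂ i₂ x hx y hy] at e
  beta_reduce at e
  rw [hxy, y2, x2, nx, nstd, kron_self] at e
  have hn' : (n : ℝ) - 1 ≠ 0 := by
    have : (3 : ℝ) ≤ n := by exact_mod_cast hn
    linarith
  -- The factorization isolates the exceptional values $\lambda=0$, $\lambda=1$ and $b=0$.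
  have hκ : 2 * coeffQ' n a b lam x + 4 * coeffQ n a b lam x ^ 2
      = 4 * (lam * (lam - 1) * b ^ 2) * (wgt n a b x)⁻¹ ^ 2 := by
    rw [coeffQ, coeffQ']
    ring
  rw [hκ] at e
  have h1' : lam - 1 ≠ 0 := sub_ne_zero.2 h1
  have hw' := hw.ne'
  have hν' := hν.ne'
  have : 4 * (lam * (lam - 1) * b ^ 2) * (wgt n a b x)⁻¹ ^ 2 * ((ν / 2) ^ 2 / (n - 1)) ≠ 0 := by
    positivity
  apply this
  linarith

/-- The profile `(a + b r²)^(-lam) (1 + s / (1 + r²))`. -/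
def randersProfile (a b lam r s : ℝ) : ℝ := (a + b * r ^ 2) ^ (-lam) * (1 + s * (1 + r ^ 2)⁻¹)

theorem hasProfile_randersProfile (hab : ∀ r ∈ Set.Ico 0 ν, 0 < a + b * r ^ 2) :
    HasProfile ν a b lam (fun _ => 1) (randersProfile a b lam) := by
  intro s₀ hs₀
  -- Since $\int_{s_0}^s\sigma^{-2}d\sigma = 1/s_0 - 1/s$, the integral term equals $u - su/s_0$.
  -- The last summand of the witness absorbs $-su/s_0$.
  refine ⟨fun r => (a + b * r ^ 2) ^ (-lam) * (1 + r ^ 2)⁻¹ + (a + b * r ^ 2) ^ (-lam) / s₀,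
    fun r hr s hs => ?_⟩
  have hs0 : s ≠ 0 := right_ne_zero_of_mul hs.ne'
  -- Both endpoints lie on the same half-line, so the singularity of the integrand is avoided.
  have h0 : (0 : ℝ) ∉ Set.uIcc s₀ s := by
    intro h
    rcases Set.mem_uIcc.1 h with ⟨h1, h2⟩ | ⟨h1, h2⟩
    · exact absurd (mul_nonpos_of_nonpos_of_nonneg h1 h2) (not_le.2 hs)
    · exact absurd (mul_nonpos_of_nonneg_of_nonpos h2 h1) (not_le.2 hs)
  have hint : ∫ σ in s₀..s, (σ ^ 2)⁻¹ * (1 : ℝ) = s₀⁻¹ - s⁻¹ := by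
    have h := integral_zpow (a := s₀) (b := s) (n := -2) (Or.inr ⟨by norm_num, h0⟩)
    have e1 : ∀ σ : ℝ, (σ ^ 2)⁻¹ * (1 : ℝ) = σ ^ (-2 : ℤ) := fun σ => by
      rw [mul_one, zpow_neg]
      norm_cast
    simp only [e1, h]
    norm_num
    ring
  have hw := hab r hr
  simp only [hint, randersProfile, Real.rpow_neg hw.le]
  field_simp
  ring

theorem isSphericallySymmetric_randersBall (hab : ∀ r ∈ Set.Ico 0 ν, 0 < a + b * r ^ 2) :
    IsSphericallySymmetric (randersBall n ν a b lam hab) (randersProfile a b lam) := by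
  intro x y
  change randers _ _ (x : E n) y = _
  by_cases hy : y = 0
  · simp [hy, randers]
  · have : ‖y‖ ≠ 0 := norm_ne_zero_iff.2 hy
    simp only [randers, randersProfile, coeffU, coeffH, wgt]
    field_simp

end Example

end FinslerGeom
end

/-! ### The main theorem. -/

theorem mainTheorem9 :
    (∀ (n : ℕ), 2 ≤ n → ∀ (M : Type*) [TopologicalSpace M] [ChartedSpace (FinslerGeom.E n) M]
      [IsManifold (𝓡 n) ∞ M] (F : FinslerGeom.FinslerMetric n M),
      F.IsWeyl → F.IsGenWeaklyWeyl) ∧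
    (∀ (n : ℕ), 3 ≤ n → ∀ (ν a b lam : ℝ), 0 < ν → (∀ r ∈ Set.Ico 0 ν, 0 < a + b * r ^ 2) →
      b ≠ 0 → lam ≠ 0 → lam ≠ 1 →
      ∃ (f : ℝ → ℝ) (φ : ℝ → ℝ → ℝ) (F : FinslerGeom.FinslerMetric n (FinslerGeom.openBall n ν)),
        ContDiff ℝ ∞ f ∧ FinslerGeom.HasProfile ν a b lam f φ ∧
        FinslerGeom.IsSphericallySymmetric F φ ∧
        F.IsDouglas ∧ F.IsWeaklyWeyl ∧ F.IsGenWeaklyWeyl ∧ ¬ F.IsWeyl) := by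
  refine ⟨fun n _ M _ _ _ F hF => hF.isWeaklyWeyl.isGenWeaklyWeyl,
    fun n hn ν a b lam hν hab hb h0 h1 => ?_⟩
  have hW := FinslerGeom.randersBall_isWeaklyWeyl (n := n) (lam := lam) hab (by omega)
  exact ⟨fun _ => 1, FinslerGeom.randersProfile a b lam, FinslerGeom.randersBall n ν a b lam hab,
    contDiff_const, FinslerGeom.hasProfile_randersProfile hab,
    FinslerGeom.isSphericallySymmetric_randersBall hab, FinslerGeom.randersBall_isDouglas hab,
    hW, hW.isGenWeaklyWeyl, FinslerGeom.not_isWeyl_randersBall hab hn hν hb h0 h1⟩
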